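/- **Setting.** Let $\Gamma$ be a countable discrete abelian group, $\alpha:\Gamma\to\Gamma$ an injective homomorphism such that $N=[\Gamma:\alpha(\Gamma)]$ is finite, $N>1$, and $\bigcap_n\alpha^n(\Gamma)$ is trivial. Let $\widehat\Gamma$ be the compact dual group with normalised Haar measure $\mu$ and let $\alpha^*:\widehat\Gamma\to\widehat\Gamma$, $\alpha^*(\omega)(\gamma)=\omega(\alpha(\gamma))$. All identities and inequalities between functions on $\widehat\Gamma$ below are understood almost everywhere. *GMRA.* Let $\pi$ be a unitary representation of $\Gamma$ and $\delta$ a unitary operator on a separable Hilbert space $\mathcal H$, with $\delta^{-1}\pi_\gamma\delta=\pi_{\alpha(\gamma)}$ for all $\gamma\in\Gamma$. A GMRA relative to $\pi$ and $\delta$ is a family $\{V_j\}_{j\in\mathbb Z}$ of closed subspaces with $V_j\subseteq V_{j+1}$, $V_{j+1}=\delta(V_j)$, $\bigcap_jV_j=\{0\}$, $\bigcup_jV_j$ dense in $\mathcal H$, and $V_0$ invariant under $\pi$. Two GMRAs $\{V_j\}$ (relative to $\pi,\delta$ on $\mathcal H$) and $\{V_j'\}$ (relative to $\pi',\delta'$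 on $\mathcal H'$) are equivalent if there is a unitary $U:\mathcal H\to\mathcal H'$ with $U(V_j)=V'_j$ for all $j$, $U\pi_\gamma=\pi'_\gamma U$ for all $\gamma$, and $U\delta=\delta'U$. *Multiplicity function.* A Borel function $m:\widehat\Gamma\to\{0,1,2,\dots\}$ is the multiplicity function associated to the GMRA if, with $\sigma_i=\{\omega:m(\omega)\ge i\}$ for $i\ge1$, there is a unitary $J:V_0\to\bigoplus_{i}L^2(\sigma_i,\mu)$ with $[J(\pi_\gamma f)](\omega)=\omega(\gamma)[J(f)](\omega)$ for all $\gamma\in\Gamma$ and $f\in V_0$. (So the GMRA has finite multiplicity and a measure that is absolutely continuous with respect to Haar measure.) *Filters.* Given such $m$ and $J$, let $C_i\in\bigoplus_jL^2(\sigma_j,\mu)$ have $i$-th coordinate $\chi_{\sigma_i}$ and all other coordinates $0$. The filter constructed from the GMRA using $J$ is a matrix $H=[h_{i,j}]_{i,j\ge1}$ of Borel functions on $\widehat\Gamma$, with $h_{i,j}$ supported in $\sigma_j$, such that $\bigoplus_jh_{i,j}=J(\delta^{-1}(J^{-1}(C_i)))$. Put $\widetilde m(\omega)=\sum_{\alpha^*(\zeta)=\omega}m(\zeta)-m(\omega)$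 and $\widetilde\sigma_k=\{\omega:\widetilde m(\omega)\ge k\}$ for $k\ge1$. A complementary filter to $H$ is a matrix $G=[g_{k,j}]_{k,j\ge1}$ of Borel functions, with $g_{k,j}$ supported in $\sigma_j$, such that for all $i,k,k'$ $$\sum_{\alpha^*(\zeta)=\omega}\sum_jg_{k,j}(\zeta)\overline{g_{k',j}(\zeta)}=N\delta_{k,k'}\chi_{\widetilde\sigma_k}(\omega),\qquad \sum_{\alpha^*(\zeta)=\omega}\sum_jg_{k,j}(\zeta)\overline{h_{i,j}(\zeta)}=0.$$ *Canonical GMRA.* Let $c$ be a Borel cross-section of $\alpha^*$ and $\tau(\omega)=c(\alpha^*(\omega))\omega^{-1}\in\ker\alpha^*$. The dilation of a Hilbert sum $\mathcal K=\bigoplus_aL^2(\widehat\Gamma,\nu_a)$ is $\mathcal D(\mathcal K)=\bigoplus_{a,\ \zeta\in\ker\alpha^*}L^2(\widehat\Gamma,\nu'_{a,\zeta})$, where $\nu'_{a,\zeta}=N\,\alpha^*_*\big(\nu_a|_{\{\tau=\zeta\}}\big)$, and $\mathcal D^{-1}:\mathcal D(\mathcal K)\to\mathcal K$ is $[\mathcal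 D^{-1}f]_a(\omega)=\sqrt N\,f_{a,\tau(\omega)}(\alpha^*(\omega))$. Let $\mathcal V_0=\bigoplus_iL^2(\sigma_i,\mu)$, $\mathcal W_0=\bigoplus_kL^2(\widetilde\sigma_k,\mu)$, $\mathcal W_{n+1}=\mathcal D(\mathcal W_n)$, and let $\mathcal H^{c}=\mathcal V_0\oplus\bigoplus_{n\ge0}\mathcal W_n$, on which $\Gamma$ acts by $[\pi^{c}_\gamma f](\omega)=\omega(\gamma)f(\omega)$. The operator $T$ on $\mathcal H^{c}$ is given by $$(Tf)_{\mathcal V_0}(\omega)=H^t(\omega)f_{\mathcal V_0}(\alpha^*(\omega))+G^t(\omega)f_{\mathcal W_0}(\alpha^*(\omega)),\qquad (Tf)_{\mathcal W_n}=\mathcal D^{-1}(f_{\mathcal W_{n+1}})\quad(n\ge0),$$ and $V_j^{m,H,G}=T^{-j}(\mathcal V_0)$ for $j\in\mathbb Z$. **Theorem.** Let $\{V_j\}$ be a GMRA relative to $\pi$ and $\delta$ with (finite) associated multiplicity function $m$, let $H$ be the filter constructed from it using a map $J$, and let $G$ be any complementary filter to $H$. Then $m$ satisfies the consistency inequality $m(\omega)\le\sum_{\alpha^*(\zeta)=\omega}m(\zeta)$,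 and $H$ satisfies the filter equations $\sum_{\alpha^*(\zeta)=\omega}\sum_jh_{i,j}(\zeta)\overline{h_{i',j}(\zeta)}=N\delta_{i,i'}\chi_{\sigma_i}(\omega)$. For every Borel cross-section $c$ of $\alpha^*$, $T$ is a well-defined unitary operator, $\{V_j^{m,H,G}\}$ is a GMRA relative to $\pi^{c}$ and $T^{-1}$, and the GMRA $\{V_j\}$ is equivalent to the canonical GMRA $\{V_j^{m,H,G}\}$. -/

import Mathlib

open MeasureTheory
open scoped ENNReal ComplexConjugate

noncomputable section

/-! ## The dual group and the dual endomorphism -/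

section Dual

variable {Γ : Type*} [CommGroup Γ] [TopologicalSpace Γ] [DiscreteTopology Γ]

instance pontryaginDualMeasurableSpace : MeasurableSpace (PontryaginDual Γ) := borel _

instance pontryaginDualBorelSpace : BorelSpace (PontryaginDual Γ) := ⟨rfl⟩

variable (Γ) in
/-- Haar measure on the (compact) dual group of `Γ`, normalised to have total mass one. -/
def dualHaar : Measure (PontryaginDual Γ) := Measure.haarMeasure ⊤

instance dualHaar_isFinite : IsFiniteMeasure (dualHaar Γ) := by
  unfold dualHaar; infer_instance

/-- The endomorphism `α^*` of the dual group: `(α^* ω) γ = ω (α γ)`. -/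
def dualEndo (α : Γ →* Γ) : PontryaginDual Γ →ₜ* PontryaginDual Γ :=
  PontryaginDual.map ⟨α, continuous_of_discreteTopology⟩

/-- The sum of `f ζ` over the (finite) set of all `ζ` with `α^* ζ = ω`. -/
def fiberSum {M : Type*} [AddCommMonoid M] (α : Γ →* Γ) (f : PontryaginDual Γ → M)
    (ω : PontryaginDual Γ) : M :=
  ∑ᶠ ζ ∈ {ζ : PontryaginDual Γ | dualEndo α ζ = ω}, f ζ

/-- A Borel cross-section of `α^*`. -/
structure CrossSection (α : Γ →* Γ) where
  toFun : PontryaginDual Γ → PontryaginDual Γ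
  measurable_toFun : Measurable toFun
  dualEndo_toFun : ∀ ω, dualEndo α (toFun ω) = ω

/-- The map `τ ω = c (α^* ω) ω⁻¹` into the kernel of `α^*`. -/
def CrossSection.tau {α : Γ →* Γ} (c : CrossSection α) (ω : PontryaginDual Γ) :
    (dualEndo α).toMonoidHom.ker :=
  ⟨c.toFun (dualEndo α ω) * ω⁻¹, by
    rw [MonoidHom.mem_ker]
    change dualEndo α (c.toFun (dualEndo α ω) * ω⁻¹) = 1
    rw [map_mul, map_inv, c.dualEndo_toFun, mul_inv_cancel]⟩

end Dual

/-! ## Unitary representations on Hilbert sums of `L²`-spaces -/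

section Representations

variable {Γ : Type*} [CommGroup Γ]

/-- A multiplicative family of linear isometries of `E`, as a unitary representation on `E`. -/
def unitaryRepOfIsometries {E : Type*} [NormedAddCommGroup E] [InnerProductSpace ℂ E]
    (φ : Γ → E →ₗᵢ[ℂ] E) (h1 : ∀ x, φ 1 x = x) (hmul : ∀ a b x, φ (a * b) x = φ a (φ b x)) :
    Γ →* (E ≃ₗᵢ[ℂ] E) where
  toFun a :=
    { toLinearEquiv := LinearEquiv.ofLinearMap (φ a).toLinearMap (φ a⁻¹).toLinearMap
        (by ext x; simp [← hmul, h1]) (by ext x; simp [← hmul, h1])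
      norm_map' := fun x => (φ a).norm_map x }
  map_one' := by ext x; exact h1 x
  map_mul' a b := by ext x; exact hmul a b x

/-- The direct sum of a family of unitary representations. -/
def hilbertSumRep {ι : Type*} {E : ι → Type*} [∀ i, NormedAddCommGroup (E i)]
    [∀ i, InnerProductSpace ℂ (E i)] (ρ : ∀ i, Γ →* (E i ≃ₗᵢ[ℂ] E i)) :
    Γ →* (lp E 2 ≃ₗᵢ[ℂ] lp E 2) :=
  unitaryRepOfIsometries
    (fun γ =>
      { toFun := fun f => ⟨fun i => ρ i γ (f i), by
          have h : Memℓp (fun i => f i) 2 := lp.memℓp f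
          rw [← memℓp_norm_iff] at h
          exact memℓp_norm_iff.mp (by simpa using h)⟩
        map_add' := fun f g => lp.ext (funext fun i => map_add (ρ i γ) (f i) (g i))
        map_smul' := fun a f => lp.ext (funext fun i => map_smul (ρ i γ) a (f i))
        norm_map' := fun f => by
          rw [lp.norm_eq_tsum_rpow (by norm_num), lp.norm_eq_tsum_rpow (by norm_num)]
          simp })
    (fun f => lp.ext (funext fun i => by simp))
    (fun a b f => lp.ext (funext fun i => by simp))

/-- The direct sum of two unitary representations. -/
def prodRep {E F : Type*} [NormedAddCommGroup E] [InnerProductSpace ℂ E]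
    [NormedAddCommGroup F] [InnerProductSpace ℂ F]
    (ρ : Γ →* (E ≃ₗᵢ[ℂ] E)) (σ : Γ →* (F ≃ₗᵢ[ℂ] F)) :
    Γ →* (WithLp 2 (E × F) ≃ₗᵢ[ℂ] WithLp 2 (E × F)) where
  toFun γ := LinearIsometryEquiv.withLpProdCongr 2 (ρ γ) (σ γ)
  map_one' := by
    refine LinearIsometryEquiv.ext fun x => (WithLp.ofLp_injective 2) (Prod.ext ?_ ?_)
    · change ρ 1 x.fst = x.fst
      rw [map_one]; rfl
    · change σ 1 x.snd = x.snd
      rw [map_one]; rfl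
  map_mul' a b := by
    refine LinearIsometryEquiv.ext fun x => (WithLp.ofLp_injective 2) (Prod.ext ?_ ?_)
    · change ρ (a * b) x.fst = ρ a (ρ b x.fst)
      rw [map_mul]; rfl
    · change σ (a * b) x.snd = σ a (σ b x.snd)
      rw [map_mul]; rfl

variable [TopologicalSpace Γ]

lemma memLp_char_mul {ν : Measure (PontryaginDual Γ)} (γ : Γ) {f : PontryaginDual Γ → ℂ}
    (hf : MemLp f 2 ν) : MemLp (fun ω => (ω γ : ℂ) * f ω) 2 ν := by
  have hc : Continuous fun ω : PontryaginDual Γ => (ω γ : ℂ) :=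
    (by fun_prop : Continuous fun z : Circle => (z : ℂ)).comp (ContinuousEvalConst.continuous_eval_const
      (F := Γ →ₜ* Circle) γ)
  exact hf.of_le (hc.aestronglyMeasurable.mul hf.1) (Filter.Eventually.of_forall fun ω => by
    rw [norm_mul, Circle.norm_coe, one_mul])

/-- Multiplication by characters, `(γ · f) ω = ω γ * f ω`, as a unitary representation of `Γ`
on `L²(ν)`. -/
def charRep (ν : Measure (PontryaginDual Γ)) : Γ →* (Lp ℂ 2 ν ≃ₗᵢ[ℂ] Lp ℂ 2 ν) :=
  unitaryRepOfIsometries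
    (fun γ =>
      { toFun := fun f => (memLp_char_mul γ (Lp.memLp f)).toLp _
        map_add' := fun f g => by
          apply Lp.ext
          filter_upwards [(memLp_char_mul γ (Lp.memLp (f + g))).coeFn_toLp, Lp.coeFn_add f g,
            Lp.coeFn_add ((memLp_char_mul γ (Lp.memLp f)).toLp _)
              ((memLp_char_mul γ (Lp.memLp g)).toLp _),
            (memLp_char_mul γ (Lp.memLp f)).coeFn_toLp,
            (memLp_char_mul γ (Lp.memLp g)).coeFn_toLp] with ω h1 h2 h3 h4 h5
          rw [h1, h2, h3, Pi.add_apply, Pi.add_apply, h4, h5, mul_add]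
        map_smul' := fun a f => by
          apply Lp.ext
          filter_upwards [(memLp_char_mul γ (Lp.memLp (a • f))).coeFn_toLp, Lp.coeFn_smul a f,
            Lp.coeFn_smul a ((memLp_char_mul γ (Lp.memLp f)).toLp _),
            (memLp_char_mul γ (Lp.memLp f)).coeFn_toLp] with ω h1 h2 h3 h4
          simp only [RingHom.id_apply]
          rw [h1, h2, h3, Pi.smul_apply, Pi.smul_apply, h4, smul_eq_mul, smul_eq_mul]
          ring
        norm_map' := fun f => by
          change ‖(memLp_char_mul γ (Lp.memLp f)).toLp _‖ = ‖f‖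
          refine le_antisymm (Lp.norm_le_norm_of_ae_le ?_) (Lp.norm_le_norm_of_ae_le ?_) <;>
          · filter_upwards [(memLp_char_mul γ (Lp.memLp f)).coeFn_toLp] with ω h1
            rw [h1, norm_mul, Circle.norm_coe, one_mul] })
    (fun f => by
      apply Lp.ext
      filter_upwards [(memLp_char_mul (1 : Γ) (Lp.memLp f)).coeFn_toLp] with ω h1
      refine h1.trans ?_
      simp)
    (fun a b f => by
      apply Lp.ext
      filter_upwards [(memLp_char_mul (a * b) (Lp.memLp f)).coeFn_toLp,
        (memLp_char_mul a (Lp.memLp ((memLp_char_mul b (Lp.memLp f)).toLp _))).coeFn_toLp,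
        (memLp_char_mul b (Lp.memLp f)).coeFn_toLp] with ω h1 h2 h3
      refine h1.trans (Eq.trans ?_ h2.symm)
      rw [h3, map_mul, Circle.coe_mul, mul_assoc])

/-- The Hilbert direct sum `⨁ᵢ L²(νᵢ)`. -/
abbrev L2Sum {ι : Type*} (ν : ι → Measure (PontryaginDual Γ)) : Type _ :=
  lp (fun i => Lp ℂ 2 (ν i)) 2

/-- The representation of `Γ` on `⨁ᵢ L²(νᵢ)` through multiplication by characters. -/
def charSumRep {ι : Type*} (ν : ι → Measure (PontryaginDual Γ)) :
    Γ →* (L2Sum ν ≃ₗᵢ[ℂ] L2Sum ν) :=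
  hilbertSumRep fun i => charRep (ν i)

end Representations

/-! ## Multiplicity functions and filters

Rows, columns and summands are numbered from `0`, so that the set with number `i` is
`σ_{i+1} = {ω | i + 1 ≤ m ω}`. -/

section Filters

variable {Γ : Type*} [CommGroup Γ] [TopologicalSpace Γ] [DiscreteTopology Γ]

/-- The sets `{ω | i < m ω}`. -/
def multSet (m : PontryaginDual Γ → ℕ) (i : ℕ) : Set (PontryaginDual Γ) := {ω | i < m ω}

/-- `m̃ ω = ∑_{α^* ζ = ω} m ζ - m ω`, as an integer. -/
def coMult (α : Γ →* Γ) (m : PontryaginDual Γ → ℕ) (ω : PontryaginDual Γ) : ℤ :=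
  fiberSum α (fun ζ => (m ζ : ℤ)) ω - m ω

/-- The sets `{ω | k < m̃ ω}`. -/
def coMultSet (α : Γ →* Γ) (m : PontryaginDual Γ → ℕ) (k : ℕ) : Set (PontryaginDual Γ) :=
  {ω | (k : ℤ) < coMult α m ω}

/-- A multiplicity function: Borel, with the consistency inequality. -/
structure IsMultiplicityFunction (α : Γ →* Γ) (m : PontryaginDual Γ → ℕ) : Prop where
  measurable : Measurable m
  le_fiberSum : ∀ᵐ ω ∂dualHaar Γ, m ω ≤ fiberSum α m ω

/-- A matrix of Borel functions on the dual group whose `j`-th column is supported in the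
`j`-th set `{ω | j < m ω}`. -/
structure IsSupportedMatrix (m : PontryaginDual Γ → ℕ) (A : ℕ → ℕ → PontryaginDual Γ → ℂ) :
    Prop where
  measurable : ∀ i j, Measurable (A i j)
  support : ∀ i j ω, ω ∉ multSet m j → A i j ω = 0

/-- `∑_{α^* ζ = ω} ∑_j A_{i,j}(ζ) conj(B_{i',j}(ζ))`. -/
def rowProduct (α : Γ →* Γ) (A B : ℕ → ℕ → PontryaginDual Γ → ℂ) (i i' : ℕ)
    (ω : PontryaginDual Γ) : ℂ :=
  fiberSum α (fun ζ => ∑' j, A i j ζ * conj (B i' j ζ)) ω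

/-- `H` is a filter relative to `m` and `α^*`. -/
structure IsFilter (α : Γ →* Γ) (m : PontryaginDual Γ → ℕ)
    (H : ℕ → ℕ → PontryaginDual Γ → ℂ) : Prop where
  supported : IsSupportedMatrix m H
  filter_eq : ∀ i i', ∀ᵐ ω ∂dualHaar Γ, rowProduct α H H i i' ω =
    if i = i' then (α.range.index : ℂ) * (multSet m i).indicator 1 ω else 0

/-- `G` is a complementary filter to `H`. -/
structure IsComplementaryFilter (α : Γ →* Γ) (m : PontryaginDual Γ → ℕ)
    (H G : ℕ → ℕ → PontryaginDual Γ → ℂ) : Prop where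
  supported : IsSupportedMatrix m G
  filter_eq : ∀ k k', ∀ᵐ ω ∂dualHaar Γ, rowProduct α G G k k' ω =
    if k = k' then (α.range.index : ℂ) * (coMultSet α m k).indicator 1 ω else 0
  orthogonal : ∀ k i, ∀ᵐ ω ∂dualHaar Γ, rowProduct α G H k i ω = 0

/-- The `j`-th coordinate of `ω ↦ Aᵗ(ω) f(α^* ω)`, where `f = ⨁ᵢ fᵢ` and `fᵢ` is a function on the
set `s i` (extended by zero). -/
def ruelleCoord (α : Γ →* Γ) (A : ℕ → ℕ → PontryaginDual Γ → ℂ) (s : ℕ → Set (PontryaginDual Γ))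
    (f : ℕ → PontryaginDual Γ → ℂ) (j : ℕ) (ω : PontryaginDual Γ) : ℂ :=
  ∑' i, A i j ω * (s i).indicator (f i) (dualEndo α ω)

/-- The measures on the summands of `⨁ᵢ L²(σ_i)`: Haar measure restricted to `σ_i`. -/
def coreMeasure (m : PontryaginDual Γ → ℕ) (i : ℕ) : Measure (PontryaginDual Γ) :=
  (dualHaar Γ).restrict (multSet m i)

instance coreMeasure_isFinite (m : PontryaginDual Γ → ℕ) (i : ℕ) :
    IsFiniteMeasure (coreMeasure m i) := by
  unfold coreMeasure; infer_instance

/-- The space `⨁ᵢ L²(σ_i)`. -/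
abbrev CoreSpace (m : PontryaginDual Γ → ℕ) : Type _ := L2Sum (coreMeasure m)

/-- The element `C_i` of `⨁ⱼ L²(σ_j)` whose `i`-th coordinate is the function `1` on `σ_i` and
whose other coordinates vanish. -/
def coreUnit (m : PontryaginDual Γ → ℕ) (i : ℕ) : CoreSpace m :=
  lp.single 2 i (Lp.const 2 (coreMeasure m i) (1 : ℂ))

end Filters

/-! ## Generalized multiresolution analyses -/

section GMRA

variable {Γ : Type*} [CommGroup Γ]
  {E : Type*} [NormedAddCommGroup E] [InnerProductSpace ℂ E]
  {E' : Type*} [NormedAddCommGroup E'] [InnerProductSpace ℂ E']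

/-- `V` is a GMRA relative to the unitary representation `π` and the unitary operator `δ`, which
are related by `δ⁻¹ π_γ δ = π_{α γ}`. -/
structure IsGMRA (α : Γ →* Γ) (π : Γ →* (E ≃ₗᵢ[ℂ] E)) (δ : E ≃ₗᵢ[ℂ] E) (V : ℤ → Submodule ℂ E) :
    Prop where
  conj_dilation : ∀ γ, δ⁻¹ * π γ * δ = π (α γ)
  isClosed : ∀ j, IsClosed (V j : Set E)
  le_succ : ∀ j, V j ≤ V (j + 1)
  succ_eq : ∀ j, V (j + 1) = (V j).map δ.toLinearEquiv.toLinearMap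
  iInf_eq_bot : ⨅ j, V j = ⊥
  dense_iUnion : Dense (⋃ j, (V j : Set E))
  invariant : ∀ γ, ∀ f ∈ V 0, π γ f ∈ V 0

/-- Equivalence of GMRAs. -/
def GMRAEquivalent (π : Γ →* (E ≃ₗᵢ[ℂ] E)) (δ : E ≃ₗᵢ[ℂ] E) (V : ℤ → Submodule ℂ E)
    (π' : Γ →* (E' ≃ₗᵢ[ℂ] E')) (δ' : E' ≃ₗᵢ[ℂ] E') (V' : ℤ → Submodule ℂ E') : Prop :=
  ∃ U : E ≃ₗᵢ[ℂ] E',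
    (∀ j, (V j).map U.toLinearEquiv.toLinearMap = V' j) ∧
    (∀ γ f, U (π γ f) = π' γ (U f)) ∧
    (∀ f, U (δ f) = δ' (U f))

lemma IsGMRA.inv_dilation_mem {α : Γ →* Γ} {π : Γ →* (E ≃ₗᵢ[ℂ] E)} {δ : E ≃ₗᵢ[ℂ] E}
    {V : ℤ → Submodule ℂ E} (hV : IsGMRA α π δ V) (f : V 0) : δ.symm (f : E) ∈ V 0 := by
  have h : (f : E) ∈ V (0 + 1) := hV.le_succ 0 f.2
  rw [hV.succ_eq] at h
  obtain ⟨g, hg, hgf⟩ := h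
  have : δ.symm (f : E) = g := by
    rw [← hgf]; exact δ.symm_apply_apply g
  rw [this]; exact hg

variable [TopologicalSpace Γ] [DiscreteTopology Γ]
  {α : Γ →* Γ} {π : Γ →* (E ≃ₗᵢ[ℂ] E)} {δ : E ≃ₗᵢ[ℂ] E} {V : ℤ → Submodule ℂ E}

/-- The unitary `J : V₀ → ⨁ᵢ L²(σ_i)` intertwines `π` on `V₀` with multiplication by characters.
Thus `m` is the multiplicity function associated to the restriction of `π` to `V₀`. -/
def IsStoneMap (hV : IsGMRA α π δ V) (m : PontryaginDual Γ → ℕ)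
    (J : V 0 ≃ₗᵢ[ℂ] CoreSpace m) : Prop :=
  ∀ γ, ∀ f : V 0, J ⟨π γ f, hV.invariant γ f f.2⟩ = charSumRep (coreMeasure m) γ (J f)

/-- `H` is the filter constructed from the GMRA through `J`: a matrix of Borel functions,
supported in the sets `σ_j`, whose `i`-th row is `J (δ⁻¹ (J⁻¹ C_i))`. -/
structure IsConstructedFilter (hV : IsGMRA α π δ V) (m : PontryaginDual Γ → ℕ)
    (J : V 0 ≃ₗᵢ[ℂ] CoreSpace m) (H : ℕ → ℕ → PontryaginDual Γ → ℂ) : Prop where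
  supported : IsSupportedMatrix m H
  row_eq : ∀ i j, H i j =ᵐ[coreMeasure m j]
    (J ⟨δ.symm (J.symm (coreUnit m i) : E), hV.inv_dilation_mem (J.symm (coreUnit m i))⟩) j

end GMRA

/-! ## The canonical GMRA -/

section Canonical

universe u

variable {Γ : Type u} [CommGroup Γ] [TopologicalSpace Γ] [DiscreteTopology Γ]

/-- The measures `ν'_{i,ζ} = N α^*_*(ν_i restricted to {τ = ζ})`. The space `⨁_{i,ζ} L²(ν'_{i,ζ})` is
the dilation of `⨁_i L²(ν_i)` by `α^*`. -/
def dilatedMeasure {α : Γ →* Γ} (c : CrossSection α) {ι : Type u}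
    (ν : ι → Measure (PontryaginDual Γ)) (p : ι × (dualEndo α).toMonoidHom.ker) :
    Measure (PontryaginDual Γ) :=
  (α.range.index : ℝ≥0∞) • ((ν p.1).restrict {ω | c.tau ω = p.2}).map (dualEndo α)

/-- The index set of the direct sum `𝓦_n`. -/
def WIndex (α : Γ →* Γ) : ℕ → Type u
  | 0 => ULift.{u} ℕ
  | n + 1 => WIndex α n × (dualEndo α).toMonoidHom.ker

/-- The measures on the summands of `𝓦_n`: for `n = 0`, Haar measure restricted to `σ̃_k`. -/
def wMeasure {α : Γ →* Γ} (c : CrossSection α) (m : PontryaginDual Γ → ℕ) :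
    (n : ℕ) → WIndex α n → Measure (PontryaginDual Γ)
  | 0 => fun k => (dualHaar Γ).restrict (coMultSet α m (ULift.down k))
  | n + 1 => dilatedMeasure c (wMeasure c m n)

/-- The space `𝓦_n`; `𝓦_0 = ⨁_k L²(σ̃_k)`, and `𝓦_{n+1}` is the dilation of `𝓦_n`. -/
abbrev WSpace {α : Γ →* Γ} (c : CrossSection α) (m : PontryaginDual Γ → ℕ) (n : ℕ) : Type u :=
  L2Sum (wMeasure c m n)

/-- The Hilbert space `𝓥_0 ⊕ ⨁_{n ≥ 0} 𝓦_n` of the canonical GMRA. -/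
abbrev CanonicalSpace {α : Γ →* Γ} (c : CrossSection α) (m : PontryaginDual Γ → ℕ) : Type u :=
  WithLp 2 (CoreSpace m × lp (fun n => WSpace c m n) 2)

/-- The representation of `Γ` on the canonical space: multiplication by characters. -/
def canonicalRep {α : Γ →* Γ} (c : CrossSection α) (m : PontryaginDual Γ → ℕ) :
    Γ →* (CanonicalSpace c m ≃ₗᵢ[ℂ] CanonicalSpace c m) :=
  prodRep (charSumRep (coreMeasure m)) (hilbertSumRep fun n => charSumRep (wMeasure c m n))

/-- The unitary operator `T` of the canonical space is given by
`(T f)_{𝓥_0} = S_H f_{𝓥_0} + S_G f_{𝓦_0}` and `(T f)_{𝓦_n} = 𝓓⁻¹ f_{𝓦_{n+1}}`, where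
`(𝓓⁻¹ f)_a (ω) = √N f_{a, τ ω} (α^* ω)`. -/
structure IsCanonicalInverseDilation {α : Γ →* Γ} (c : CrossSection α)
    (m : PontryaginDual Γ → ℕ) (H G : ℕ → ℕ → PontryaginDual Γ → ℂ)
    (T : CanonicalSpace c m ≃ₗᵢ[ℂ] CanonicalSpace c m) : Prop where
  core : ∀ f : CanonicalSpace c m, ∀ j, (T f).fst j =ᵐ[coreMeasure m j] fun ω =>
    ruelleCoord α H (multSet m) (fun i => f.fst i) j ω +
      ruelleCoord α G (coMultSet α m)
        (fun k => (f.snd 0 : WSpace c m 0) (ULift.up k : ULift.{u} ℕ)) j ω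
  detail : ∀ f : CanonicalSpace c m, ∀ n, ∀ a : WIndex α n,
    ((T f).snd n : WSpace c m n) a =ᵐ[wMeasure c m n a] fun ω =>
      (Real.sqrt α.range.index : ℂ) *
        (f.snd (n + 1) : WSpace c m (n + 1)) ((a, c.tau ω) : WIndex α n × _) (dualEndo α ω)

/-- There is at most one such operator. -/
lemma IsCanonicalInverseDilation.unique {α : Γ →* Γ} {c : CrossSection α}
    {m : PontryaginDual Γ → ℕ} {H G : ℕ → ℕ → PontryaginDual Γ → ℂ}
    {T T' : CanonicalSpace c m ≃ₗᵢ[ℂ] CanonicalSpace c m}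
    (hT : IsCanonicalInverseDilation c m H G T) (hT' : IsCanonicalInverseDilation c m H G T') :
    T = T' := by
  refine LinearIsometryEquiv.ext fun f => (WithLp.ofLp_injective 2) (Prod.ext ?_ ?_)
  · exact lp.ext (funext fun j => Lp.ext ((hT.core f j).trans (hT'.core f j).symm))
  · exact lp.ext (funext fun n => lp.ext (funext fun a =>
      Lp.ext ((hT.detail f n a).trans (hT'.detail f n a).symm)))

/-- The core subspace `𝓥_0` of the canonical space. -/
def canonicalCore {α : Γ →* Γ} (c : CrossSection α) (m : PontryaginDual Γ → ℕ) :
    Submodule ℂ (CanonicalSpace c m) where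
  carrier := {f | f.snd = 0}
  add_mem' {f g} hf hg := by
    simp only [Set.mem_ofPred_eq] at hf hg ⊢
    rw [WithLp.add_snd, hf, hg, add_zero]
  zero_mem' := rfl
  smul_mem' a f hf := by
    simp only [Set.mem_ofPred_eq] at hf ⊢
    rw [WithLp.smul_snd, hf, smul_zero]

/-- The subspaces `𝓥_j = T^{-j}(𝓥_0)`, for `j ∈ ℤ`. -/
def canonicalSubspace {α : Γ →* Γ} (c : CrossSection α) (m : PontryaginDual Γ → ℕ)
    (T : CanonicalSpace c m ≃ₗᵢ[ℂ] CanonicalSpace c m) (j : ℤ) :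
    Submodule ℂ (CanonicalSpace c m) :=
  (canonicalCore c m).map (T ^ (-j)).toLinearEquiv.toLinearMap

end Canonical

end

noncomputable section

set_option linter.unusedSectionVars false

/-! ## The dual group: countability, fibers of the dual endomorphism, uniqueness of Fourier
coefficients -/

section DualLemmas

variable {Γ : Type*} [CommGroup Γ] [TopologicalSpace Γ] [DiscreteTopology Γ]

/-! A GMRA is determined by its core: `δ⁻¹` maps `V 0` into itself, and the spaces `δⁿ(V 0)` exhaust
a dense subspace. Through `J`, the operator `δ⁻¹` becomes an isometry `S` of `⨁ᵢ L²(σ_i)`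
(`coreIsometry`) with `S π_γ = π_{α γ} S`. Everything about filters follows from this covariance by
Fourier analysis. The `γ`-th Fourier coefficient of a fibrewise product of two rows is `N` times an
inner product in which one row is multiplied by the character `α γ`
(`integral_char_mul_fiberSum_rowInner`). For the rows `S C_i`, covariance and isometry reduce it to
`⟨C_{i'}, π_γ C_i⟩`, a Fourier coefficient of `δ_{i,i'} χ_{σ_i}`. Uniqueness of Fourier coefficients
(`ae_eq_zero_of_fourier`) gives the filter equations (`isFilter_of_covariant`). Moreover `S` is the
operator `f ↦ Hᵗ (f ∘ α^*)`: both are covariant, they agree on the `C_i`, and the translates of the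
`C_i` span a dense subspace (`isRuelle_of_covariant`).

The rest is linear algebra in the fibres of `α^*`. Over almost every `ω` a row becomes a vector in a
space of dimension `∑ m(ζ)`, where the first `m(ω)` rows of `H` are nonzero and orthogonal; hence
the consistency inequality. The first `m̃(ω)` rows of `G` are orthogonal to these and to each other,
and the count is now exactly the dimension, so together they span (`fiberVec_eq_zero`). Hence `H`
and `G` define isometries into the core space whose ranges are orthogonal and jointly total
(`eq_zero_of_forall_inner_eq_zero`). As `𝓓⁻¹` is unitary from each `𝓦_{n+1}` onto `𝓦_n`
(`exists_undilate`), the operator `T` is unitary (`exists_isShiftType`).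

On the canonical core `T` acts as `S`, that is, as `δ⁻¹` does on `V 0`. The map `J` therefore
extends to `T^{-n} J δ^{-n}` on `V_n` and, by continuity, to the whole space; it is onto because
vectors with finitely many nonzero `𝓦_n`-components are dense and are carried into the core by a
power of `T` (`IsGMRA.exists_extension`, `IsShiftType.dense`). The GMRA axioms for the canonical
subspaces, including the trivial intersection, are transported along this unitary instead of being
checked directly. -/

instance pontryaginDual_secondCountable [Countable Γ] :
    SecondCountableTopology (PontryaginDual Γ) := by
  have : SecondCountableTopology C(Γ, Circle) := inferInstance
  exact (ContinuousMonoidHom.isInducing_toContinuousMap Γ Circle).secondCountableTopology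

instance dualHaar_isProbability : IsProbabilityMeasure (dualHaar Γ) :=
  ⟨Measure.haarMeasure_self (K₀ := (⊤ : TopologicalSpace.PositiveCompacts (PontryaginDual Γ)))⟩

instance dualHaar_isHaar : (dualHaar Γ).IsHaarMeasure := by
  unfold dualHaar; infer_instance

/-- The kernel of the dual endomorphism consists of the characters of `Γ ⧸ α(Γ)`. -/
def dualKerEquiv (α : Γ →* Γ) :
    (dualEndo α).toMonoidHom.ker ≃ ((Γ ⧸ α.range) →* Circle) where
  toFun κ := QuotientGroup.lift α.range ((κ : PontryaginDual Γ) : Γ →ₜ* Circle).toMonoidHom (by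
    rintro _ ⟨γ, rfl⟩
    have h := DFunLike.congr_fun ((MonoidHom.mem_ker).1 κ.2) γ
    exact h)
  invFun χ := ⟨(⟨χ.comp (QuotientGroup.mk' α.range), continuous_of_discreteTopology⟩ :
      Γ →ₜ* Circle), by
    refine MonoidHom.mem_ker.2 (PontryaginDual.ext fun γ => ?_)
    change χ (QuotientGroup.mk (α γ)) = 1
    rw [(QuotientGroup.eq_one_iff (N := α.range) (α γ)).2 (MonoidHom.mem_range.2 ⟨γ, rfl⟩), map_one]⟩
  left_inv κ := by
    apply Subtype.ext
    exact PontryaginDual.ext fun γ => rfl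
  right_inv χ := by
    ext γ
    rfl

variable {α : Γ →* Γ} [α.range.FiniteIndex]

instance dualKer_finite : Finite (dualEndo α).toMonoidHom.ker := by
  have h := (CommGroup.monoidHom_mulEquiv_of_hasEnoughRootsOfUnity (Γ ⧸ α.range) Circle).some
  have e2 : ((Γ ⧸ α.range) →* Circle) ≃ (Γ ⧸ α.range) :=
    (MulEquiv.monoidHomCongrRight (toUnits (G := Circle))).toEquiv.trans h.toEquiv
  exact Finite.of_equiv _ ((dualKerEquiv α).trans e2).symm

instance dualKer_fintype : Fintype (dualEndo α).toMonoidHom.ker := Fintype.ofFinite _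

/-- The circle has enough roots of unity, so the finite abelian group `Γ ⧸ α(Γ)` is isomorphic to
its own character group. This is the source of the factor `N` in every fibre sum. -/
lemma card_dualKer : Fintype.card (dualEndo α).toMonoidHom.ker = α.range.index := by
  have h := (CommGroup.monoidHom_mulEquiv_of_hasEnoughRootsOfUnity (Γ ⧸ α.range) Circle).some
  have e2 : ((Γ ⧸ α.range) →* Circle) ≃ (Γ ⧸ α.range) :=
    (MulEquiv.monoidHomCongrRight (toUnits (G := Circle))).toEquiv.trans h.toEquiv
  rw [← Nat.card_eq_fintype_card, Nat.card_congr ((dualKerEquiv α).trans e2)]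
  rfl

lemma dualEndo_apply (α : Γ →* Γ) (ω : PontryaginDual Γ) (γ : Γ) :
    dualEndo α ω γ = ω (α γ) := rfl

lemma continuous_dualEndo (α : Γ →* Γ) : Continuous (dualEndo α) := (dualEndo α).continuous_toFun

lemma dualEndo_mul_ker (ω : PontryaginDual Γ) (κ : (dualEndo α).toMonoidHom.ker) :
    dualEndo α (ω * κ) = dualEndo α ω := by
  have : dualEndo α (κ : PontryaginDual Γ) = 1 := MonoidHom.mem_ker.1 κ.2
  rw [map_mul, this, mul_one]

/-- The fibre through `ω` is the coset of the kernel at `ω`. -/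
lemma fiberSum_dualEndo {M : Type*} [AddCommMonoid M] (f : PontryaginDual Γ → M)
    (ω : PontryaginDual Γ) :
    fiberSum α f (dualEndo α ω) = ∑ κ : (dualEndo α).toMonoidHom.ker, f (ω * κ) := by
  have hr : {ζ : PontryaginDual Γ | dualEndo α ζ = dualEndo α ω} =
      Set.range fun κ : (dualEndo α).toMonoidHom.ker => ω * (κ : PontryaginDual Γ) := by
    ext ζ
    constructor
    · intro h
      refine ⟨⟨ω⁻¹ * ζ, ?_⟩, by simp⟩
      rw [MonoidHom.mem_ker]
      change dualEndo α (ω⁻¹ * ζ) = 1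
      have h' : dualEndo α ζ = dualEndo α ω := h
      rw [map_mul, map_inv, h', inv_mul_cancel]
    · rintro ⟨κ, rfl⟩
      exact dualEndo_mul_ker ω κ
  rw [fiberSum, hr, finsum_mem_range fun κ κ' h => Subtype.ext (mul_left_cancel h),
    finsum_eq_sum_of_fintype]

/-- The cross-section supplies a base point in each fibre that depends measurably on `ω`. -/
lemma fiberSum_eq_sum (c : CrossSection α) {M : Type*} [AddCommMonoid M]
    (f : PontryaginDual Γ → M) (ω : PontryaginDual Γ) :
    fiberSum α f ω = ∑ κ : (dualEndo α).toMonoidHom.ker, f (c.toFun ω * κ) := by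
  rw [← fiberSum_dualEndo, c.dualEndo_toFun]

/-- The cross-section makes `α^*` surjective, and a continuous surjective homomorphism of compact
groups carries normalised Haar measure to normalised Haar measure. -/
lemma CrossSection.measurePreserving (c : CrossSection α) :
    MeasurePreserving (dualEndo α) (dualHaar Γ) (dualHaar Γ) :=
  MonoidHom.measurePreserving (f := (dualEndo α).toMonoidHom) (continuous_dualEndo α)
    (fun ω => ⟨c.toFun ω, c.dualEndo_toFun ω⟩) rfl

variable [Countable Γ]

lemma measurable_fiberSum (c : CrossSection α) {M : Type*} [AddCommMonoid M] [MeasurableSpace M]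
    [MeasurableAdd₂ M] {f : PontryaginDual Γ → M} (hf : Measurable f) :
    Measurable (fiberSum α f) := by
  have h : fiberSum α f = fun ω => ∑ κ : (dualEndo α).toMonoidHom.ker, f (c.toFun ω * κ) :=
    funext (fiberSum_eq_sum c f)
  rw [h]
  exact Finset.measurable_fun_sum _ fun κ _ => hf.comp (c.measurable_toFun.mul_const _)

/-- After composing with `α^*`, the integrand is a sum of `N` translates of `f`, each with the same
integral. -/
lemma lintegral_fiberSum (c : CrossSection α) {f : PontryaginDual Γ → ℝ≥0∞} (hf : Measurable f) :
    ∫⁻ ω, fiberSum α f ω ∂dualHaar Γ = α.range.index * ∫⁻ ω, f ω ∂dualHaar Γ := by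
  rw [← c.measurePreserving.lintegral_comp (measurable_fiberSum c hf)]
  simp_rw [fiberSum_dualEndo]
  rw [lintegral_finsetSum (f := fun (κ : (dualEndo α).toMonoidHom.ker) ω => f (ω * κ)) _
    fun κ _ => hf.comp (measurable_mul_const _)]
  simp_rw [lintegral_mul_right_eq_self]
  rw [Finset.sum_const, Finset.card_univ, card_dualKer, nsmul_eq_mul]

lemma integrable_fiberSum (c : CrossSection α) {f : PontryaginDual Γ → ℂ} (hf : Measurable f)
    (hi : Integrable f (dualHaar Γ)) : Integrable (fiberSum α f) (dualHaar Γ) := by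
  rw [← c.measurePreserving.integrable_comp (measurable_fiberSum c hf).aestronglyMeasurable]
  have : fiberSum α f ∘ dualEndo α =
      fun ω => ∑ κ : (dualEndo α).toMonoidHom.ker, f (ω * κ) := funext (fiberSum_dualEndo f)
  rw [this]
  exact integrable_finsetSum _ fun κ _ => hi.comp_mul_right _

lemma integral_fiberSum (c : CrossSection α) {f : PontryaginDual Γ → ℂ} (hf : Measurable f)
    (hi : Integrable f (dualHaar Γ)) :
    ∫ ω, fiberSum α f ω ∂dualHaar Γ = α.range.index * ∫ ω, f ω ∂dualHaar Γ := by
  have h := integral_map (μ := dualHaar Γ) (continuous_dualEndo α).measurable.aemeasurable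
    (f := fiberSum α f) (measurable_fiberSum c hf).aestronglyMeasurable
  rw [c.measurePreserving.map_eq] at h
  rw [h]
  simp_rw [fiberSum_dualEndo]
  rw [integral_finsetSum _ fun κ _ => hi.comp_mul_right _]
  simp_rw [integral_mul_right_eq_self]
  rw [Finset.sum_const, Finset.card_univ, card_dualKer, nsmul_eq_mul]

lemma fiberSum_congr {M : Type*} [AddCommMonoid M] {f g : PontryaginDual Γ → M}
    {ω : PontryaginDual Γ} (h : ∀ ζ, dualEndo α ζ = ω → f ζ = g ζ) :
    fiberSum α f ω = fiberSum α g ω :=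
  finsum_mem_congr rfl h

end DualLemmas

/-! ### Stone–Weierstrass on the dual group and uniqueness of Fourier coefficients. -/

section Fourier

variable {Γ : Type*} [CommGroup Γ] [TopologicalSpace Γ] [DiscreteTopology Γ]

/-- Evaluation at `γ`, as a continuous complex function on the dual group. -/
def evalChar (γ : Γ) : C(PontryaginDual Γ, ℂ) :=
  ⟨fun ω => (ω γ : ℂ), (by fun_prop : Continuous fun z : Circle => (z : ℂ)).comp
    (ContinuousEvalConst.continuous_eval_const (F := Γ →ₜ* Circle) γ)⟩

lemma evalChar_apply (γ : Γ) (ω : PontryaginDual Γ) : evalChar γ ω = (ω γ : ℂ) := rfl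

lemma evalChar_mul (γ γ' : Γ) : evalChar (γ * γ') = evalChar γ * evalChar γ' := by
  ext ω
  simp [evalChar_apply]

lemma evalChar_one : evalChar (1 : Γ) = 1 := by
  ext ω
  simp [evalChar_apply]

lemma star_evalChar (γ : Γ) : star (evalChar γ) = evalChar γ⁻¹ := by
  ext ω
  simp [evalChar_apply, ← Circle.coe_inv_eq_conj]

variable (Γ) in
/-- Trigonometric polynomials on the dual group. -/
def trigPolynomials : StarSubalgebra ℂ C(PontryaginDual Γ, ℂ) where
  toSubalgebra := (Submodule.span ℂ (Set.range (evalChar (Γ := Γ)))).toSubalgebra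
    (Submodule.subset_span ⟨1, evalChar_one⟩) (by
      intro x y hx hy
      have := Submodule.mul_mem_mul hx hy
      rw [Submodule.span_mul_span] at this
      refine Submodule.span_mono ?_ this
      rintro _ ⟨_, ⟨a, rfl⟩, _, ⟨b, rfl⟩, rfl⟩
      exact ⟨a * b, evalChar_mul a b⟩)
  star_mem' := by
    intro x hx
    change star x ∈ Submodule.span ℂ (Set.range (evalChar (Γ := Γ)))
    have hx' : x ∈ Submodule.span ℂ (Set.range (evalChar (Γ := Γ))) := hx
    induction hx' using Submodule.span_induction with
    | mem y hy =>
      obtain ⟨a, rfl⟩ := hy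
      exact Submodule.subset_span ⟨a⁻¹, (star_evalChar a).symm⟩
    | zero => simp
    | add y z hy hz h1 h2 => rw [star_add]; exact Submodule.add_mem _ (h1 hy) (h2 hz)
    | smul a y hy h1 => rw [star_smul]; exact Submodule.smul_mem _ _ (h1 hy)

/-- Stone–Weierstrass: two points of the dual that agree at every `γ` are equal. -/
lemma trigPolynomials_dense : (trigPolynomials Γ).topologicalClosure = ⊤ := by
  refine ContinuousMap.starSubalgebra_topologicalClosure_eq_top_of_separatesPoints _ ?_
  intro ω ω' h
  obtain ⟨γ, hγ⟩ : ∃ γ, ω γ ≠ ω' γ := by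
    by_contra hh
    push Not at hh
    exact h (PontryaginDual.ext hh)
  refine ⟨evalChar γ, ⟨evalChar γ, Submodule.subset_span ⟨γ, rfl⟩, rfl⟩, ?_⟩
  simpa [evalChar_apply, Circle.coe_inj] using hγ

/-- Integration against `f` is a functional bounded by the `L¹`-norm of `f`, so it vanishes as soon
as it does on the dense trigonometric polynomials. -/
lemma integral_continuous_mul_eq_zero {f : PontryaginDual Γ → ℂ} (hf : Integrable f (dualHaar Γ))
    (h : ∀ γ : Γ, ∫ ω, (ω γ : ℂ) * f ω ∂dualHaar Γ = 0) (φ : C(PontryaginDual Γ, ℂ)) :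
    ∫ ω, φ ω * f ω ∂dualHaar Γ = 0 := by
  have hint : ∀ φ : C(PontryaginDual Γ, ℂ), Integrable (fun ω => φ ω * f ω) (dualHaar Γ) :=
    fun φ => hf.bdd_mul (c := ‖φ‖) φ.continuous.aestronglyMeasurable
      (Filter.Eventually.of_forall fun ω => φ.norm_coe_le_norm ω)
  let I : C(PontryaginDual Γ, ℂ) →ₗ[ℂ] ℂ :=
    { toFun := fun φ => ∫ ω, φ ω * f ω ∂dualHaar Γ
      map_add' := fun φ ψ => by
        simp_rw [ContinuousMap.add_apply, add_mul]
        exact integral_add (hint φ) (hint ψ)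
      map_smul' := fun a φ => by
        simp_rw [ContinuousMap.smul_apply, smul_eq_mul, mul_assoc]
        exact integral_const_mul a _ }
  let Ic : C(PontryaginDual Γ, ℂ) →L[ℂ] ℂ := I.mkContinuous (∫ ω, ‖f ω‖ ∂dualHaar Γ) fun φ => by
    refine (norm_integral_le_integral_norm _).trans ?_
    rw [mul_comm, ← integral_const_mul]
    refine integral_mono (hint φ).norm (hf.norm.const_mul _) fun ω => ?_
    simp only [norm_mul]
    exact mul_le_mul_of_nonneg_right (φ.norm_coe_le_norm ω) (norm_nonneg _)
  have hz : ∀ φ ∈ trigPolynomials Γ, Ic φ = 0 := by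
    intro φ hφ
    have hφ' : φ ∈ Submodule.span ℂ (Set.range (evalChar (Γ := Γ))) := hφ
    induction hφ' using Submodule.span_induction with
    | mem y hy => obtain ⟨a, rfl⟩ := hy; exact h a
    | zero => simp
    | add y z hy hz h1 h2 => rw [map_add, h1 hy, h2 hz, add_zero]
    | smul a y hy h1 => rw [map_smul, h1 hy, smul_zero]
  have hmem : φ ∈ closure (trigPolynomials Γ : Set C(PontryaginDual Γ, ℂ)) := by
    rw [← StarSubalgebra.topologicalClosure_coe, trigPolynomials_dense]; trivial
  exact closure_minimal (fun φ hφ => hz φ hφ) (isClosed_singleton.preimage Ic.continuous) hmem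

/-- An integrable function on the dual group whose Fourier coefficients vanish is zero almost
everywhere. -/
lemma ae_eq_zero_of_fourier [Countable Γ] {f : PontryaginDual Γ → ℂ}
    (hf : Integrable f (dualHaar Γ))
    (h : ∀ γ : Γ, ∫ ω, (ω γ : ℂ) * f ω ∂dualHaar Γ = 0) : f =ᵐ[dualHaar Γ] 0 := by
  -- Metrizability makes the indicator of a closed set a pointwise limit of continuous functions
  -- bounded by `1`; dominated convergence then passes from continuous test functions to closed
  -- sets.
  have : TopologicalSpace.MetrizableSpace (PontryaginDual Γ) :=
    TopologicalSpace.metrizableSpace_of_t3_secondCountable _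
  refine ae_eq_zero_of_forall_setIntegral_isClosed_eq_zero hf fun F hF => ?_
  have h0 : ∀ n, ∫ ω, ((hF.apprSeq n ω : ℝ) : ℂ) * f ω ∂dualHaar Γ = 0 := fun n =>
    integral_continuous_mul_eq_zero hf h
      ⟨fun ω => ((hF.apprSeq n ω : ℝ) : ℂ), Complex.continuous_ofReal.comp
        (NNReal.continuous_coe.comp (hF.apprSeq n).continuous)⟩
  rw [← integral_indicator hF.measurableSet]
  have hlim : Filter.Tendsto (fun n => ∫ ω, ((hF.apprSeq n ω : ℝ) : ℂ) * f ω ∂dualHaar Γ)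
      Filter.atTop (nhds (∫ ω, F.indicator f ω ∂dualHaar Γ)) := by
    refine tendsto_integral_of_dominated_convergence (fun ω => ‖f ω‖) (fun n => ?_) hf.norm
      (fun n => Filter.Eventually.of_forall fun ω => ?_) (Filter.Eventually.of_forall fun ω => ?_)
    · exact (Complex.continuous_ofReal.comp (NNReal.continuous_coe.comp
        (hF.apprSeq n).continuous)).aestronglyMeasurable.mul hf.1
    · rw [norm_mul, Complex.norm_real, Real.norm_of_nonneg (NNReal.coe_nonneg _)]
      exact mul_le_of_le_one_left (norm_nonneg _)
        (by exact_mod_cast HasOuterApproxClosed.apprSeq_apply_le_one hF n ω)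
    · have h1 := tendsto_pi_nhds.1 (HasOuterApproxClosed.tendsto_apprSeq hF) ω
      have h2 : Filter.Tendsto (fun n => ((hF.apprSeq n ω : ℝ) : ℂ)) Filter.atTop
          (nhds (((F.indicator (fun _ => (1 : NNReal)) ω : NNReal) : ℝ) : ℂ)) :=
        (Complex.continuous_ofReal.tendsto _).comp ((NNReal.continuous_coe.tendsto _).comp h1)
      have h3 := h2.mul_const (f ω)
      convert h3 using 2
      by_cases hω : ω ∈ F <;> simp [hω]
  simp_rw [h0] at hlim
  exact (tendsto_nhds_unique hlim tendsto_const_nhds)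

end Fourier

/-! ## Hilbert sums of `L²`-spaces through functions -/

section HilbertSums

/-- Squared norms are taken in `ℝ≥0∞`, where sums and integrals can be interchanged without
summability conditions. -/
lemma lp_enorm_sq {ι : Type*} {E : ι → Type*} [∀ i, NormedAddCommGroup (E i)] (f : lp E 2) :
    ‖f‖ₑ ^ 2 = ∑' i, ‖f i‖ₑ ^ 2 := by
  have h := lp.hasSum_norm (p := 2) (by norm_num) f
  simp only [ENNReal.toReal_ofNat, Real.rpow_two] at h
  have h2 := ENNReal.ofReal_tsum_of_nonneg (fun i => sq_nonneg ‖f i‖) h.summable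
  rw [h.tsum_eq] at h2
  simpa [ENNReal.ofReal_pow, ofReal_norm] using h2

lemma memℓp_two_of_tsum_enorm_sq {ι : Type*} {E : ι → Type*} [∀ i, NormedAddCommGroup (E i)]
    {f : ∀ i, E i} (h : ∑' i, ‖f i‖ₑ ^ 2 ≠ ∞) : Memℓp f 2 := by
  refine memℓp_gen ?_
  have h2 := ENNReal.summable_toReal h
  simpa using h2

variable {X : Type*} [MeasurableSpace X]

lemma lintegral_enorm_sq_eq {ν : Measure X} (f : X → ℂ) :
    ∫⁻ ω, ‖f ω‖ₑ ^ 2 ∂ν = eLpNorm f 2 ν ^ 2 := by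
  have h := eLpNorm_nnreal_pow_eq_lintegral (μ := ν) (f := f) (p := 2) (by norm_num)
  simpa using h.symm

lemma L2_enorm_sq {ν : Measure X} (f : Lp ℂ 2 ν) : ‖f‖ₑ ^ 2 = ∫⁻ ω, ‖f ω‖ₑ ^ 2 ∂ν := by
  rw [Lp.enorm_def, lintegral_enorm_sq_eq]

lemma memLp_two_of_lintegral {ν : Measure X} {f : X → ℂ} (hf : AEStronglyMeasurable f ν)
    (h : ∫⁻ ω, ‖f ω‖ₑ ^ 2 ∂ν ≠ ∞) : MemLp f 2 ν := by
  refine ⟨hf, ?_⟩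
  rw [lintegral_enorm_sq_eq] at h
  exact lt_of_le_of_ne le_top fun hh => h (by simp [hh])

end HilbertSums

/-! ### Hilbert sums of `L²`-spaces over the dual group. -/

section L2Sums

variable {Γ : Type*} [CommGroup Γ] [TopologicalSpace Γ]

lemma charRep_coe (ν : Measure (PontryaginDual Γ)) (γ : Γ) (f : Lp ℂ 2 ν) :
    charRep ν γ f =ᵐ[ν] fun ω => (ω γ : ℂ) * f ω :=
  (memLp_char_mul γ (Lp.memLp f)).coeFn_toLp

variable {ι κ : Type*} {ν : ι → Measure (PontryaginDual Γ)} {ν' : κ → Measure (PontryaginDual Γ)}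

lemma charSumRep_apply (γ : Γ) (f : L2Sum ν) (i : ι) :
    charSumRep ν γ f i = charRep (ν i) γ (f i) := rfl

lemma charSumRep_coe (γ : Γ) (f : L2Sum ν) (i : ι) :
    charSumRep ν γ f i =ᵐ[ν i] fun ω => (ω γ : ℂ) * f i ω :=
  charRep_coe _ _ _

lemma L2Sum.ext_ae {f g : L2Sum ν} (h : ∀ i, f i =ᵐ[ν i] g i) : f = g :=
  lp.ext (funext fun i => Lp.ext (h i))

lemma L2Sum.enorm_sq (f : L2Sum ν) : ‖f‖ₑ ^ 2 = ∑' i, ∫⁻ ω, ‖f i ω‖ₑ ^ 2 ∂ν i := by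
  rw [lp_enorm_sq]
  exact tsum_congr fun i => L2_enorm_sq _

lemma L2Sum.exists_coe_ae_eq (F : ι → PontryaginDual Γ → ℂ)
    (hF : ∀ i, AEStronglyMeasurable (F i) (ν i))
    (h : ∑' i, ∫⁻ ω, ‖F i ω‖ₑ ^ 2 ∂ν i ≠ ∞) : ∃ f : L2Sum ν, ∀ i, f i =ᵐ[ν i] F i := by
  have hL : ∀ i, MemLp (F i) 2 (ν i) := fun i =>
    memLp_two_of_lintegral (hF i) (ENNReal.ne_top_of_tsum_ne_top h i)
  refine ⟨⟨fun i => (hL i).toLp, memℓp_two_of_tsum_enorm_sq ?_⟩, fun i => (hL i).coeFn_toLp⟩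
  convert h using 3 with i
  rw [L2_enorm_sq]
  exact lintegral_congr_ae ((hL i).coeFn_toLp.mono fun ω hω => by simp only [hω])

/-- A linear, norm-preserving formula on families of functions defines a linear isometry between
Hilbert sums of `L²`-spaces. -/
lemma L2Sum.exists_linearIsometry
    (Φ : (ι → PontryaginDual Γ → ℂ) → κ → PontryaginDual Γ → ℂ)
    (hcongr : ∀ f g, (∀ i, f i =ᵐ[ν i] g i) → ∀ k, Φ f k =ᵐ[ν' k] Φ g k)
    (hadd : ∀ f g k, Φ (f + g) k =ᵐ[ν' k] Φ f k + Φ g k)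
    (hsmul : ∀ (a : ℂ) f k, Φ (a • f) k =ᵐ[ν' k] a • Φ f k)
    (hmeas : ∀ f, (∀ i, Measurable (f i)) → ∀ k, AEStronglyMeasurable (Φ f k) (ν' k))
    (hnorm : ∀ f, (∀ i, Measurable (f i)) →
      ∑' k, ∫⁻ ω, ‖Φ f k ω‖ₑ ^ 2 ∂ν' k = ∑' i, ∫⁻ ω, ‖f i ω‖ₑ ^ 2 ∂ν i) :
    ∃ L : L2Sum ν →ₗᵢ[ℂ] L2Sum ν', ∀ f k, L f k =ᵐ[ν' k] Φ (fun i => f i) k := by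
  have hm : ∀ f : L2Sum ν, ∀ i, Measurable (f i) := fun f i => (Lp.stronglyMeasurable _).measurable
  have hex : ∀ f : L2Sum ν, ∃ g : L2Sum ν', ∀ k, g k =ᵐ[ν' k] Φ (fun i => f i) k := fun f =>
    L2Sum.exists_coe_ae_eq _ (hmeas _ (hm f)) (by
      rw [hnorm _ (hm f), ← L2Sum.enorm_sq]; simp)
  choose L hL using hex
  refine ⟨{ toFun := L, map_add' := fun f g => ?_, map_smul' := fun a f => ?_,
            norm_map' := fun f => ?_ }, hL⟩
  · refine L2Sum.ext_ae fun k => ?_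
    have h1 : Φ (fun i => (f + g) i) k =ᵐ[ν' k] Φ ((fun i => ⇑(f i)) + fun i => ⇑(g i)) k :=
      hcongr _ _ (fun i => Lp.coeFn_add (f i) (g i)) k
    have h2 : (L f + L g) k =ᵐ[ν' k] L f k + L g k := Lp.coeFn_add (L f k) (L g k)
    exact ((hL (f + g) k).trans (h1.trans (hadd _ _ k))).trans
      (h2.trans ((hL f k).add (hL g k))).symm
  · refine L2Sum.ext_ae fun k => ?_
    have h1 : Φ (fun i => (a • f) i) k =ᵐ[ν' k] Φ (a • fun i => ⇑(f i)) k :=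
      hcongr _ _ (fun i => Lp.coeFn_smul a (f i)) k
    have h2 : (a • L f) k =ᵐ[ν' k] a • L f k := Lp.coeFn_smul a (L f k)
    exact ((hL (a • f) k).trans (h1.trans (hsmul _ _ k))).trans
      (h2.trans ((hL f k).const_smul a)).symm
  · have h : ‖L f‖ₑ ^ 2 = ‖f‖ₑ ^ 2 := by
      rw [L2Sum.enorm_sq, L2Sum.enorm_sq, ← hnorm _ (hm f)]
      exact tsum_congr fun k => lintegral_congr_ae ((hL f k).mono fun ω hω => by simp only [hω])
    have h' : ‖L f‖ₑ = ‖f‖ₑ := (ENNReal.pow_right_strictMono two_ne_zero).injective h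
    exact congrArg ENNReal.toReal h'

end L2Sums

/-! ## Rows of functions and their fiberwise products -/

section Rows

variable {Γ : Type*} [CommGroup Γ] [TopologicalSpace Γ] [DiscreteTopology Γ]

/-- A row of Borel functions on the dual group whose `j`-th entry is supported in the `j`-th
set `{ω | j < m ω}`. -/
structure IsSupportedRow (m : PontryaginDual Γ → ℕ) (u : ℕ → PontryaginDual Γ → ℂ) : Prop where
  measurable : ∀ j, Measurable (u j)
  support : ∀ j ω, m ω ≤ j → u j ω = 0

lemma IsSupportedMatrix.row {m : PontryaginDual Γ → ℕ} {A : ℕ → ℕ → PontryaginDual Γ → ℂ}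
    (hA : IsSupportedMatrix m A) (i : ℕ) : IsSupportedRow m (A i) :=
  ⟨hA.measurable i, fun j ω h => hA.support i j ω (not_lt.2 h)⟩

lemma measurableSet_multSet {m : PontryaginDual Γ → ℕ} (hm : Measurable m) (i : ℕ) :
    MeasurableSet (multSet m i) :=
  measurableSet_lt measurable_const hm

/-- The pointwise product `∑_j u_j conj(v_j)` of two rows. -/
def rowInner (u v : ℕ → PontryaginDual Γ → ℂ) (ω : PontryaginDual Γ) : ℂ :=
  ∑' j, u j ω * conj (v j ω)

lemma rowProduct_eq (α : Γ →* Γ) (A B : ℕ → ℕ → PontryaginDual Γ → ℂ) (i i' : ℕ) :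
    rowProduct α A B i i' = fiberSum α (rowInner (A i) (B i')) := rfl

variable {m : PontryaginDual Γ → ℕ} {u v : ℕ → PontryaginDual Γ → ℂ}

lemma IsSupportedRow.rowInner_eq (hu : IsSupportedRow m u) (ω : PontryaginDual Γ) :
    rowInner u v ω = ∑ j ∈ Finset.range (m ω), u j ω * conj (v j ω) :=
  tsum_eq_sum fun j hj => by
    rw [hu.support j ω (not_lt.1 fun h => hj (Finset.mem_range.2 h)), zero_mul]

lemma measurable_conj {f : PontryaginDual Γ → ℂ} (hf : Measurable f) :
    Measurable fun ω => conj (f ω) :=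
  Complex.continuous_conj.measurable.comp hf

lemma measurable_rowInner (hu : ∀ j, Measurable (u j)) (hv : ∀ j, Measurable (v j)) :
    Measurable (rowInner u v) :=
  Measurable.tsum fun j => (hu j).mul (measurable_conj (hv j))

/-- Multiplication of a row by a character. -/
def charRow (γ : Γ) (u : ℕ → PontryaginDual Γ → ℂ) : ℕ → PontryaginDual Γ → ℂ :=
  fun j ω => (ω γ : ℂ) * u j ω

lemma measurable_eval (γ : Γ) : Measurable fun ω : PontryaginDual Γ => (ω γ : ℂ) :=
  (evalChar γ).continuous.measurable

lemma IsSupportedRow.charRow (hu : IsSupportedRow m u) (γ : Γ) : IsSupportedRow m (charRow γ u) :=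
  ⟨fun j => (measurable_eval γ).mul (hu.measurable j), fun j ω h => by
    rw [_root_.charRow, hu.support j ω h, mul_zero]⟩

lemma rowInner_charRow (γ : Γ) (ω : PontryaginDual Γ) :
    rowInner (charRow γ u) v ω = (ω γ : ℂ) * rowInner u v ω := by
  simp_rw [rowInner, charRow, mul_assoc]
  exact tsum_mul_left

/-- The row `u` consists of representatives of the components of `F`. -/
def IsRowOf (F : CoreSpace m) (u : ℕ → PontryaginDual Γ → ℂ) : Prop :=
  ∀ j, u j =ᵐ[coreMeasure m j] F j

lemma IsRowOf.charRow {F : CoreSpace m} (h : IsRowOf F u) (γ : Γ) :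
    IsRowOf (charSumRep (coreMeasure m) γ F) (charRow γ u) := fun j => by
  filter_upwards [h j, charSumRep_coe γ F j] with ω h1 h2
  rw [h2, _root_.charRow, h1]

lemma exists_isRowOf (hm : Measurable m) (F : CoreSpace m) :
    ∃ u, IsSupportedRow m u ∧ IsRowOf F u := by
  refine ⟨fun j => (multSet m j).indicator (F j), ⟨fun j =>
    (Lp.stronglyMeasurable _).measurable.indicator (measurableSet_multSet hm j), fun j ω h =>
    Set.indicator_of_notMem (s := multSet m j) (fun hh => not_lt.2 h hh) _⟩, fun j => ?_⟩
  exact indicator_ae_eq_restrict (measurableSet_multSet hm j)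

lemma setLIntegral_row (hm : Measurable m) (hu : IsSupportedRow m u) (j : ℕ) :
    ∫⁻ ω, ‖u j ω‖ₑ ^ 2 ∂coreMeasure m j = ∫⁻ ω, ‖u j ω‖ₑ ^ 2 ∂dualHaar Γ := by
  rw [coreMeasure, ← lintegral_indicator (measurableSet_multSet hm j)]
  congr 1
  ext ω
  by_cases h : ω ∈ multSet m j
  · rw [Set.indicator_of_mem h]
  · rw [Set.indicator_of_notMem h, hu.support j ω (not_lt.1 h)]; simp

lemma tsum_setLIntegral_row (hm : Measurable m) (hu : IsSupportedRow m u) :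
    ∑' j, ∫⁻ ω, ‖u j ω‖ₑ ^ 2 ∂coreMeasure m j =
      ∫⁻ ω, ∑' j, ‖u j ω‖ₑ ^ 2 ∂dualHaar Γ := by
  rw [lintegral_tsum fun j => ((hu.measurable j).enorm.pow_const 2).aemeasurable]
  exact tsum_congr fun j => setLIntegral_row hm hu j

lemma IsRowOf.enorm_sq (hm : Measurable m) {F : CoreSpace m} (hu : IsSupportedRow m u)
    (h : IsRowOf F u) : ‖F‖ₑ ^ 2 = ∫⁻ ω, ∑' j, ‖u j ω‖ₑ ^ 2 ∂dualHaar Γ := by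
  rw [L2Sum.enorm_sq, ← tsum_setLIntegral_row hm hu]
  exact tsum_congr fun j => lintegral_congr_ae ((h j).mono fun ω hω => by simp only [hω])

lemma enorm_mul_conj_le (a b : ℂ) : ‖a * conj b‖ₑ ≤ ‖a‖ₑ ^ 2 + ‖b‖ₑ ^ 2 := by
  rw [enorm_mul]
  have hb : ‖conj b‖ₑ = ‖b‖ₑ := by
    rw [← ofReal_norm, ← ofReal_norm, RCLike.norm_conj]
  rw [hb]
  rcases le_total ‖a‖ₑ ‖b‖ₑ with h | h
  · calc ‖a‖ₑ * ‖b‖ₑ ≤ ‖b‖ₑ * ‖b‖ₑ := by gcongr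
      _ = ‖b‖ₑ ^ 2 := (sq _).symm
      _ ≤ _ := le_add_self
  · calc ‖a‖ₑ * ‖b‖ₑ ≤ ‖a‖ₑ * ‖a‖ₑ := by gcongr
      _ = ‖a‖ₑ ^ 2 := (sq _).symm
      _ ≤ _ := le_self_add

/-- The absolute convergence that permits summing and integrating products of rows in either order.
-/
lemma tsum_lintegral_row_mul_ne_top (hm : Measurable m) {F F' : CoreSpace m}
    (hu : IsSupportedRow m u) (hv : IsSupportedRow m v) (h : IsRowOf F u) (h' : IsRowOf F' v) :
    ∑' j, ∫⁻ ω, ‖u j ω * conj (v j ω)‖ₑ ∂dualHaar Γ ≠ ∞ := by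
  have h1 : ∑' j, ∫⁻ ω, ‖u j ω * conj (v j ω)‖ₑ ∂dualHaar Γ ≤ ‖F‖ₑ ^ 2 + ‖F'‖ₑ ^ 2 := by
    rw [h.enorm_sq hm hu, h'.enorm_sq hm hv,
      lintegral_tsum fun j => ((hu.measurable j).enorm.pow_const 2).aemeasurable,
      lintegral_tsum fun j => ((hv.measurable j).enorm.pow_const 2).aemeasurable,
      ← ENNReal.tsum_add]
    refine ENNReal.tsum_le_tsum fun j => ?_
    rw [← lintegral_add_left ((hu.measurable j).enorm.pow_const 2)]
    exact lintegral_mono fun ω => enorm_mul_conj_le _ _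
  exact ne_top_of_le_ne_top (by simp) h1

lemma integrable_rowInner (hm : Measurable m) {F F' : CoreSpace m}
    (hu : IsSupportedRow m u) (hv : IsSupportedRow m v) (h : IsRowOf F u) (h' : IsRowOf F' v) :
    Integrable (rowInner u v) (dualHaar Γ) := by
  refine ⟨(measurable_rowInner hu.measurable hv.measurable).aestronglyMeasurable, ?_⟩
  refine lt_of_le_of_lt ?_ (tsum_lintegral_row_mul_ne_top hm hu hv h h').lt_top
  rw [← lintegral_tsum (f := fun j ω => ‖u j ω * conj (v j ω)‖ₑ) fun j =>
    ((hu.measurable j).mul (measurable_conj (hv.measurable j))).enorm.aemeasurable]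
  exact lintegral_mono fun ω => enorm_tsum_le_tsum_enorm

/-- The order of `F'` and `F` reflects that `inner` is conjugate-linear in its first argument. -/
lemma integral_rowInner (hm : Measurable m) {F F' : CoreSpace m}
    (hu : IsSupportedRow m u) (hv : IsSupportedRow m v) (h : IsRowOf F u) (h' : IsRowOf F' v) :
    ∫ ω, rowInner u v ω ∂dualHaar Γ = inner ℂ F' F := by
  unfold rowInner
  rw [integral_tsum (f := fun j ω => u j ω * conj (v j ω)) (fun j =>
    ((hu.measurable j).mul (measurable_conj (hv.measurable j))).aestronglyMeasurable)
    (tsum_lintegral_row_mul_ne_top hm hu hv h h'), lp.inner_eq_tsum]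
  refine tsum_congr fun j => ?_
  rw [L2.inner_def, ← setIntegral_eq_integral_of_forall_compl_eq_zero (s := multSet m j)
    fun ω hω => by rw [hu.support j ω (not_lt.1 hω), zero_mul]]
  refine integral_congr_ae ?_
  filter_upwards [h j, h' j] with ω h1 h2
  rw [h1, h2, RCLike.inner_apply]

variable {α : Γ →* Γ} [α.range.FiniteIndex] [Countable Γ]

lemma integrable_fiberSum_rowInner (c : CrossSection α) (hm : Measurable m) {F F' : CoreSpace m}
    (hu : IsSupportedRow m u) (hv : IsSupportedRow m v) (h : IsRowOf F u) (h' : IsRowOf F' v) :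
    Integrable (fiberSum α (rowInner u v)) (dualHaar Γ) :=
  integrable_fiberSum c (measurable_rowInner hu.measurable hv.measurable)
    (integrable_rowInner hm hu hv h h')

/-- The Fourier coefficients of the fiberwise product of two rows. -/
lemma integral_char_mul_fiberSum_rowInner (c : CrossSection α) (hm : Measurable m)
    {F F' : CoreSpace m} (hu : IsSupportedRow m u) (hv : IsSupportedRow m v) (h : IsRowOf F u)
    (h' : IsRowOf F' v) (γ : Γ) :
    ∫ ω, (ω γ : ℂ) * fiberSum α (rowInner u v) ω ∂dualHaar Γ =
      α.range.index * inner ℂ F' (charSumRep (coreMeasure m) (α γ) F) := by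
  rw [← integral_rowInner hm (hu.charRow (α γ)) hv (h.charRow (α γ)) h',
    ← integral_fiberSum c
      (measurable_rowInner (hu.charRow (α γ)).measurable hv.measurable)
      (integrable_rowInner hm (hu.charRow (α γ)) hv (h.charRow (α γ)) h')]
  congr 1
  ext ω
  -- On the fibre over `ω` the function `ζ ↦ ζ (α γ)` has the constant value `ω γ`, so it can be
  -- moved through the fibre sum.
  rw [fiberSum_eq_sum c, fiberSum_eq_sum c, Finset.mul_sum]
  refine Finset.sum_congr rfl fun κ _ => ?_
  rw [rowInner_charRow, ← dualEndo_apply, dualEndo_mul_ker, c.dualEndo_toFun]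

/-- The coefficient at `γ = 1` of the fibrewise product is `N` times the inner product. -/
lemma inner_eq_zero_of_fiberSum_rowInner (c : CrossSection α) (hm : Measurable m)
    {F F' : CoreSpace m} (hu : IsSupportedRow m u) (hv : IsSupportedRow m v) (h : IsRowOf F u)
    (h' : IsRowOf F' v) (h0 : fiberSum α (rowInner u v) =ᵐ[dualHaar Γ] 0) :
    inner ℂ F' F = 0 := by
  have h1 := integral_char_mul_fiberSum_rowInner c hm hu hv h h' 1
  have h2 : ∫ ω, (((ω : PontryaginDual Γ) (1 : Γ) : Circle) : ℂ) * fiberSum α (rowInner u v) ω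
      ∂dualHaar Γ = 0 := by
    rw [integral_congr_ae (g := 0)]
    · simp
    · filter_upwards [h0] with ω hω
      rw [hω]; simp
  rw [h2, map_one, map_one] at h1
  rcases mul_eq_zero.1 h1.symm with h3 | h3
  · exact absurd (Nat.cast_eq_zero.1 h3) Subgroup.FiniteIndex.index_ne_zero
  · exact h3

/-- In the converse direction, orthogonality to all translates by `α(Γ)` kills every Fourier
coefficient, so it forces orthogonality fibre by fibre. -/
lemma fiberSum_rowInner_ae_eq_zero (c : CrossSection α) (hm : Measurable m)
    {F F' : CoreSpace m} (hu : IsSupportedRow m u) (hv : IsSupportedRow m v) (h : IsRowOf F u)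
    (h' : IsRowOf F' v)
    (h0 : ∀ γ, inner ℂ F' (charSumRep (coreMeasure m) (α γ) F) = 0) :
    fiberSum α (rowInner u v) =ᵐ[dualHaar Γ] 0 :=
  ae_eq_zero_of_fourier (integrable_fiberSum_rowInner c hm hu hv h h') fun γ => by
    rw [integral_char_mul_fiberSum_rowInner c hm hu hv h h', h0, mul_zero]

lemma inner_coreUnit (hm : Measurable m) (i : ℕ) (F : CoreSpace m) :
    inner ℂ (coreUnit m i) F = ∫ ω, (multSet m i).indicator (F i) ω ∂dualHaar Γ := by
  rw [coreUnit, lp.inner_single_left, L2.inner_def,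
    integral_indicator (measurableSet_multSet hm i)]
  refine integral_congr_ae ?_
  filter_upwards [Lp.coeFn_const (p := 2) (μ := coreMeasure m i) (1 : ℂ)] with ω h1
  rw [h1, Function.const_apply, RCLike.inner_apply, map_one, mul_one]

lemma coreUnit_coe_self (i : ℕ) : coreUnit m i i =ᵐ[coreMeasure m i] fun _ => 1 := by
  rw [coreUnit, lp.single_apply_self]
  exact Lp.coeFn_const (p := 2) (μ := coreMeasure m i) (1 : ℂ)

lemma coreUnit_coe_ne {i j : ℕ} (h : j ≠ i) : coreUnit m i j = 0 :=
  lp.single_apply_ne _ _ _ h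

lemma integrable_indicator_coe (hm : Measurable m) (F : CoreSpace m) (i : ℕ) :
    Integrable ((multSet m i).indicator (F i)) (dualHaar Γ) :=
  (integrable_indicator_iff (measurableSet_multSet hm i)).2
    ((Lp.memLp (F i)).integrable (by norm_num))

/-- The translates of the elements `C_i` by characters span a dense subspace. -/
lemma dense_span_coreUnit (hm : Measurable m) :
    Dense (Submodule.span ℂ (Set.range fun p : Γ × ℕ =>
      charSumRep (coreMeasure m) p.1 (coreUnit m p.2)) : Set (CoreSpace m)) := by
  rw [Submodule.dense_iff_topologicalClosure_eq_top, Submodule.topologicalClosure_eq_top_iff,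
    Submodule.eq_bot_iff]
  intro F hF
  rw [Submodule.mem_orthogonal] at hF
  refine L2Sum.ext_ae fun i => ?_
  have h0 : (multSet m i).indicator (F i) =ᵐ[dualHaar Γ] 0 := by
    refine ae_eq_zero_of_fourier (integrable_indicator_coe hm F i) fun γ => ?_
    -- The translate by `γ⁻¹` is used so that unitarity puts the character `γ` on `F`.
    have h1 := hF _ (Submodule.subset_span ⟨(γ⁻¹, i), rfl⟩)
    have h2 : inner ℂ (coreUnit m i) (charSumRep (coreMeasure m) γ F) = 0 := by
      rw [← h1, ← LinearIsometryEquiv.inner_map_map (charSumRep (coreMeasure m) γ⁻¹)]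
      congr 1
      change (charSumRep (coreMeasure m) γ⁻¹ * charSumRep (coreMeasure m) γ) F = F
      rw [← map_mul, inv_mul_cancel, map_one]; rfl
    rw [inner_coreUnit hm] at h2
    rw [← h2]
    refine integral_congr_ae ?_
    have h3 := (ae_restrict_iff' (measurableSet_multSet hm i)).1 (charSumRep_coe γ F i)
    filter_upwards [h3] with ω h4
    by_cases hω : ω ∈ multSet m i
    · rw [Set.indicator_of_mem hω, Set.indicator_of_mem hω, h4 hω]
    · rw [Set.indicator_of_notMem hω, Set.indicator_of_notMem hω, mul_zero]
  have h1 : F i =ᵐ[coreMeasure m i] 0 := by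
    have h2 := ae_restrict_of_ae (s := multSet m i) h0
    exact (indicator_ae_eq_restrict (measurableSet_multSet hm i)).symm.trans h2
  exact h1.trans (Lp.coeFn_zero _ _ _).symm

end Rows

/-! ## Filter equations and linear algebra in the fibers -/

section FilterEquations

variable {Γ : Type*} [CommGroup Γ] [TopologicalSpace Γ] [DiscreteTopology Γ]
  {α : Γ →* Γ} [α.range.FiniteIndex] [Countable Γ]
  {m : PontryaginDual Γ → ℕ} {u v : ℕ → PontryaginDual Γ → ℂ}

lemma inner_coreUnit_charSumRep (hm : Measurable m) (γ : Γ) (i i' : ℕ) :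
    inner ℂ (coreUnit m i') (charSumRep (coreMeasure m) γ (coreUnit m i)) =
      if i = i' then ∫ ω, (ω γ : ℂ) * (multSet m i).indicator 1 ω ∂dualHaar Γ else 0 := by
  rw [inner_coreUnit hm]
  split_ifs with h
  · subst h
    refine integral_congr_ae ?_
    have h3 := (ae_restrict_iff' (measurableSet_multSet hm i)).1
      ((charSumRep_coe γ (coreUnit m i) i).and (coreUnit_coe_self (m := m) i))
    filter_upwards [h3] with ω h4
    by_cases hω : ω ∈ multSet m i
    · rw [Set.indicator_of_mem hω, Set.indicator_of_mem hω, (h4 hω).1, (h4 hω).2]; rfl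
    · rw [Set.indicator_of_notMem hω, Set.indicator_of_notMem hω, mul_zero]
  · have h0 : charSumRep (coreMeasure m) γ (coreUnit m i) i' = 0 := by
      rw [charSumRep_apply, coreUnit_coe_ne (Ne.symm h), map_zero]
    rw [h0, integral_eq_zero_of_ae]
    have h3 := (ae_restrict_iff' (measurableSet_multSet hm i')).1
      (Lp.coeFn_zero ℂ 2 (coreMeasure m i'))
    filter_upwards [h3] with ω h4
    by_cases hω : ω ∈ multSet m i'
    · rw [Set.indicator_of_mem hω, h4 hω]
    · rw [Set.indicator_of_notMem hω]; rfl

/-- A covariant isometry of `⨁ᵢ L²(σ_i)` yields a filter. -/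
lemma isFilter_of_covariant (c : CrossSection α) (hm : Measurable m)
    (S : CoreSpace m →ₗᵢ[ℂ] CoreSpace m)
    (hS : ∀ γ f, S (charSumRep (coreMeasure m) γ f) = charSumRep (coreMeasure m) (α γ) (S f))
    {H : ℕ → ℕ → PontryaginDual Γ → ℂ} (hH : IsSupportedMatrix m H)
    (hrow : ∀ i, IsRowOf (S (coreUnit m i)) (H i)) : IsFilter α m H := by
  refine ⟨hH, fun i i' => ?_⟩
  set g : PontryaginDual Γ → ℂ := fun ω =>
    if i = i' then (α.range.index : ℂ) * (multSet m i).indicator 1 ω else 0 with hg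
  have hind : Integrable ((multSet m i).indicator (1 : PontryaginDual Γ → ℂ)) (dualHaar Γ) :=
    (integrable_const (1 : ℂ)).indicator (measurableSet_multSet hm i)
  have hgi : Integrable g (dualHaar Γ) := by
    by_cases h : i = i'
    · simpa [hg, h] using hind.const_mul (α.range.index : ℂ)
    · simp [hg, h]
  have hfi := integrable_fiberSum_rowInner c hm (hH.row i) (hH.row i') (hrow i) (hrow i')
  have hb : ∀ (γ : Γ) {f : PontryaginDual Γ → ℂ}, Integrable f (dualHaar Γ) →
      Integrable (fun ω => (ω γ : ℂ) * f ω) (dualHaar Γ) := fun γ f hf =>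
    hf.bdd_mul (c := 1) (evalChar γ).continuous.aestronglyMeasurable
      (Filter.Eventually.of_forall fun ω => (Circle.norm_coe (ω γ)).le)
  -- Covariance turns the `α γ`-translate of `S C_i` into `S` of the `γ`-translate of `C_i`; the
  -- isometry `S` then drops out, leaving `N` times a coefficient of an indicator.
  have h0 := ae_eq_zero_of_fourier (hfi.sub hgi) fun γ => by
    simp only [Pi.sub_apply, mul_sub]
    rw [integral_sub (hb γ hfi) (hb γ hgi),
      integral_char_mul_fiberSum_rowInner c hm (hH.row i) (hH.row i') (hrow i) (hrow i'), ← hS,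
      S.inner_map_map, inner_coreUnit_charSumRep hm, sub_eq_zero]
    by_cases h : i = i'
    · simp only [hg, h, if_true, ← integral_const_mul]
      congr 1
      ext ω
      ring
    · simp [hg, h]
  filter_upwards [h0] with ω hω
  rw [rowProduct_eq]
  exact sub_eq_zero.1 hω

/-- The values of a row over a fiber of `α^*`. -/
def fiberVec (c : CrossSection α) (m : PontryaginDual Γ → ℕ) (ω : PontryaginDual Γ)
    (u : ℕ → PontryaginDual Γ → ℂ) :
    EuclideanSpace ℂ (Σ κ : (dualEndo α).toMonoidHom.ker, Fin (m (c.toFun ω * κ))) :=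
  WithLp.toLp 2 fun p => u p.2 (c.toFun ω * p.1)

/-- At each point of the fibre only the entries below `m` survive, so fibrewise products are inner
products in a finite-dimensional space. Support of one of the two rows is enough. -/
lemma inner_fiberVec (c : CrossSection α) (hu : IsSupportedRow m u) (ω : PontryaginDual Γ) :
    inner ℂ (fiberVec c m ω v) (fiberVec c m ω u) = fiberSum α (rowInner u v) ω := by
  rw [fiberSum_eq_sum c, PiLp.inner_apply, Fintype.sum_sigma]
  refine Finset.sum_congr rfl fun κ _ => ?_
  rw [hu.rowInner_eq, Finset.sum_range]
  rfl

lemma card_fiber (c : CrossSection α) (ω : PontryaginDual Γ) :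
    Fintype.card (Σ κ : (dualEndo α).toMonoidHom.ker, Fin (m (c.toFun ω * κ))) =
      fiberSum α m ω := by
  rw [Fintype.card_sigma, fiberSum_eq_sum c]
  simp

/-- The rows of `A` are supported in the sets `{ω | j < m ω}`, and orthogonal over the fibers of
`α^*`, with norms prescribed by `n`. -/
structure IsRowFilter (α : Γ →* Γ) (m n : PontryaginDual Γ → ℕ)
    (A : ℕ → ℕ → PontryaginDual Γ → ℂ) : Prop where
  supported : IsSupportedMatrix m A
  filter_eq : ∀ i i', ∀ᵐ ω ∂dualHaar Γ, rowProduct α A A i i' ω =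
    if i = i' then (α.range.index : ℂ) * (multSet n i).indicator 1 ω else 0

lemma IsFilter.isRowFilter {H : ℕ → ℕ → PontryaginDual Γ → ℂ} (hH : IsFilter α m H) :
    IsRowFilter α m m H := ⟨hH.supported, hH.filter_eq⟩

/-- The function `m̃`, with negative values replaced by zero. -/
def coMultNat (α : Γ →* Γ) (m : PontryaginDual Γ → ℕ) (ω : PontryaginDual Γ) : ℕ :=
  (coMult α m ω).toNat

/-- Since `k ≥ 0`, truncating `m̃` at zero does not change its superlevel sets; `H` and `G` can thus
be treated by the same lemmas on `IsRowFilter`. -/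
lemma coMultSet_eq (α : Γ →* Γ) (m : PontryaginDual Γ → ℕ) :
    coMultSet α m = multSet (coMultNat α m) := by
  ext k ω
  change (k : ℤ) < coMult α m ω ↔ k < (coMult α m ω).toNat
  exact Int.lt_toNat.symm

lemma coMult_eq (c : CrossSection α) (m : PontryaginDual Γ → ℕ) (ω : PontryaginDual Γ) :
    coMult α m ω = ((fiberSum α m ω : ℕ) : ℤ) - m ω := by
  rw [coMult, fiberSum_eq_sum c, fiberSum_eq_sum c]
  push_cast
  rfl

lemma measurable_coMultNat (c : CrossSection α) (hm : Measurable m) :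
    Measurable (coMultNat α m) := by
  have h : coMultNat α m = fun ω => fiberSum α m ω - m ω := by
    ext ω
    rw [coMultNat, coMult_eq c]
    omega
  rw [h]
  exact (measurable_fiberSum c hm).sub hm

lemma IsComplementaryFilter.isRowFilter {H G : ℕ → ℕ → PontryaginDual Γ → ℂ}
    (hG : IsComplementaryFilter α m H G) : IsRowFilter α m (coMultNat α m) G :=
  ⟨hG.supported, fun k k' => by rw [← coMultSet_eq]; exact hG.filter_eq k k'⟩

lemma index_ne_zero_complex : (α.range.index : ℂ) ≠ 0 :=
  Nat.cast_ne_zero.2 Subgroup.FiniteIndex.index_ne_zero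

lemma IsRowFilter.inner_fiberVec {n : PontryaginDual Γ → ℕ} {A : ℕ → ℕ → PontryaginDual Γ → ℂ}
    (c : CrossSection α) (hA : IsRowFilter α m n A) :
    ∀ᵐ ω ∂dualHaar Γ, ∀ i i', i < n ω →
      inner ℂ (fiberVec c m ω (A i')) (fiberVec c m ω (A i)) =
        if i = i' then (α.range.index : ℂ) else 0 := by
  filter_upwards [ae_all_iff.2 fun i => ae_all_iff.2 fun i' => hA.filter_eq i i'] with ω hω i i' hi
  rw [_root_.inner_fiberVec c (hA.supported.row i), ← rowProduct_eq, hω]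
  have : ω ∈ multSet n i := hi
  rw [Set.indicator_of_mem this, Pi.one_apply, mul_one]

/-- The first `n ω` rows restrict to nonzero orthogonal vectors over the fibre, and the space that
holds them has dimension `fiberSum α m ω`. -/
lemma IsRowFilter.le_fiberSum {n : PontryaginDual Γ → ℕ} {A : ℕ → ℕ → PontryaginDual Γ → ℂ}
    (c : CrossSection α) (hA : IsRowFilter α m n A) :
    ∀ᵐ ω ∂dualHaar Γ, n ω ≤ fiberSum α m ω := by
  filter_upwards [hA.inner_fiberVec c] with ω hω
  have hli : LinearIndependent ℂ fun i : Fin (n ω) => fiberVec c m ω (A i) := by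
    refine linearIndependent_of_ne_zero_of_inner_eq_zero (𝕜 := ℂ) (fun i h0 => ?_)
      fun i i' h => ?_
    · have h1 := hω i i i.2
      rw [h0, inner_zero_left, if_pos rfl] at h1
      exact index_ne_zero_complex h1.symm
    · exact (hω i' i i'.2).trans (if_neg fun hh => h (Fin.ext hh.symm))
  have h := hli.fintype_card_le_finrank
  rwa [finrank_euclideanSpace, card_fiber, Fintype.card_fin] at h

/-- Over almost every fiber, the rows of a filter and of a complementary filter span the space of
all vectors. -/
lemma fiberVec_eq_zero (c : CrossSection α) {H G : ℕ → ℕ → PontryaginDual Γ → ℂ}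
    (hH : IsFilter α m H) (hG : IsComplementaryFilter α m H G) :
    ∀ᵐ ω ∂dualHaar Γ, ∀ x, (∀ i < m ω, inner ℂ (fiberVec c m ω (H i)) x = 0) →
      (∀ k < coMultNat α m ω, inner ℂ (fiberVec c m ω (G k)) x = 0) → x = 0 := by
  filter_upwards [hH.isRowFilter.inner_fiberVec c, hG.isRowFilter.inner_fiberVec c,
    hH.isRowFilter.le_fiberSum c,
    ae_all_iff.2 fun k => ae_all_iff.2 fun i => hG.orthogonal k i] with ω h1 h2 h3 h4 x hx hx'
  let b : Fin (m ω) ⊕ Fin (coMultNat α m ω) → EuclideanSpace ℂ _ :=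
    Sum.elim (fun i => fiberVec c m ω (H i)) fun k => fiberVec c m ω (G k)
  have h5 : ∀ k i, inner ℂ (fiberVec c m ω (H i)) (fiberVec c m ω (G k)) = 0 := fun k i => by
    rw [inner_fiberVec c (hG.supported.row k), ← rowProduct_eq, h4]
  have hli : LinearIndependent ℂ b := by
    refine linearIndependent_of_ne_zero_of_inner_eq_zero (𝕜 := ℂ) ?_ ?_
    · rintro (i | k) h0
      · have h6 := h1 i i i.2
        rw [show fiberVec c m ω (H i) = 0 from h0, inner_zero_left, if_pos rfl] at h6
        exact index_ne_zero_complex h6.symm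
      · have h6 := h2 k k k.2
        rw [show fiberVec c m ω (G k) = 0 from h0, inner_zero_left, if_pos rfl] at h6
        exact index_ne_zero_complex h6.symm
    · rintro (i | k) (i' | k') h
      · change inner ℂ (fiberVec c m ω (H i)) (fiberVec c m ω (H i')) = 0
        rw [h1 i' i i'.2, if_neg fun hh => h (congrArg Sum.inl (Fin.ext hh.symm))]
      · exact h5 k' i
      · exact inner_eq_zero_symm.1 (h5 k i')
      · change inner ℂ (fiberVec c m ω (G k)) (fiberVec c m ω (G k')) = 0
        rw [h2 k' k k'.2, if_neg fun hh => h (congrArg Sum.inr (Fin.ext hh.symm))]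
  -- The consistency inequality `h3` makes the truncated subtraction in `coMultNat` exact, so the
  -- vectors are as many as the dimension.
  have hcard : Fintype.card (Fin (m ω) ⊕ Fin (coMultNat α m ω)) =
      Module.finrank ℂ (EuclideanSpace ℂ
        (Σ κ : (dualEndo α).toMonoidHom.ker, Fin (m (c.toFun ω * κ)))) := by
    rw [finrank_euclideanSpace, card_fiber, Fintype.card_sum, Fintype.card_fin, Fintype.card_fin,
      coMultNat, coMult_eq c]
    omega
  have hspan := hli.span_eq_top_of_card_eq_finrank' hcard
  have hmem : x ∈ (Submodule.span ℂ (Set.range b))ᗮ := by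
    rw [Submodule.mem_orthogonal]
    intro y hy
    induction hy using Submodule.span_induction with
    | mem y hy =>
      obtain ⟨i | k, rfl⟩ := hy
      · exact hx i i.2
      · exact hx' k k.2
    | zero => exact inner_zero_left _
    | add y z _ _ hy hz => rw [inner_add_left, hy, hz, add_zero]
    | smul a y _ hy => rw [inner_smul_left, hy, mul_zero]
  rw [hspan, Submodule.top_orthogonal_eq_bot] at hmem
  exact hmem

end FilterEquations

/-! ## The isometries attached to filters -/

section Ruelle

variable {Γ : Type*} [CommGroup Γ] [TopologicalSpace Γ] [DiscreteTopology Γ]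
  {α : Γ →* Γ} [α.range.FiniteIndex] [Countable Γ]
  {m n n' : PontryaginDual Γ → ℕ} {A B : ℕ → ℕ → PontryaginDual Γ → ℂ}
  {f g : ℕ → PontryaginDual Γ → ℂ}

lemma ruelleCoord_eq_sum (j : ℕ) (ω : PontryaginDual Γ) :
    ruelleCoord α A (multSet n) f j ω =
      ∑ i ∈ Finset.range (n (dualEndo α ω)), A i j ω * f i (dualEndo α ω) := by
  rw [ruelleCoord, tsum_eq_sum (s := Finset.range (n (dualEndo α ω)))]
  · refine Finset.sum_congr rfl fun i hi => ?_
    have : dualEndo α ω ∈ multSet n i := Finset.mem_range.1 hi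
    rw [Set.indicator_of_mem this]
  · intro i hi
    have : dualEndo α ω ∉ multSet n i := fun h => hi (Finset.mem_range.2 h)
    rw [Set.indicator_of_notMem this, mul_zero]

lemma isSupportedRow_ruelleCoord (hn : Measurable n) (hA : IsSupportedMatrix m A)
    (hf : ∀ i, Measurable (f i)) : IsSupportedRow m (ruelleCoord α A (multSet n) f) := by
  refine ⟨fun j => ?_, fun j ω h => ?_⟩
  · exact Measurable.tsum fun i => (hA.measurable i j).mul
      (((hf i).indicator (measurableSet_multSet hn i)).comp (continuous_dualEndo α).measurable)
  · rw [ruelleCoord_eq_sum]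
    exact Finset.sum_eq_zero fun i _ => by rw [(hA.row i).support j ω h, zero_mul]

/-- Preimages of null sets under `α^*` are null, so `f ↦ Aᵗ (f ∘ α^*)` is well defined on
`L²`-classes. -/
lemma ruelleCoord_ae_congr (c : CrossSection α) (hn : Measurable n)
    (h : ∀ i, f i =ᵐ[(dualHaar Γ).restrict (multSet n i)] g i) :
    ∀ᵐ ω ∂dualHaar Γ, ∀ j,
      ruelleCoord α A (multSet n) f j ω = ruelleCoord α A (multSet n) g j ω := by
  have h1 : ∀ᵐ ω ∂dualHaar Γ, ∀ i, ω ∈ multSet n i → f i ω = g i ω :=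
    ae_all_iff.2 fun i => (ae_restrict_iff' (measurableSet_multSet hn i)).1 (h i)
  filter_upwards [c.measurePreserving.quasiMeasurePreserving.ae h1] with ω hω j
  rw [ruelleCoord_eq_sum, ruelleCoord_eq_sum]
  exact Finset.sum_congr rfl fun i hi => by rw [hω i (Finset.mem_range.1 hi)]

/-- Functions composed with `α^*` are constant on fibres, so they factor out and leave the fibrewise
Gram matrix of the rows of `A` against those of `B`. Norms and orthogonality of the operators are
both read off from this identity. -/
lemma fiberSum_rowInner_ruelleCoord (c : CrossSection α) (hA : IsSupportedMatrix m A)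
    (ω : PontryaginDual Γ) :
    fiberSum α (rowInner (ruelleCoord α A (multSet n) f) (ruelleCoord α B (multSet n') g)) ω =
      ∑ i ∈ Finset.range (n ω), ∑ k ∈ Finset.range (n' ω),
        f i ω * conj (g k ω) * rowProduct α A B i k ω := by
  have key : ∀ ζ, dualEndo α ζ = ω →
      rowInner (ruelleCoord α A (multSet n) f) (ruelleCoord α B (multSet n') g) ζ =
      ∑ i ∈ Finset.range (n ω), ∑ k ∈ Finset.range (n' ω),
        f i ω * conj (g k ω) * rowInner (A i) (B k) ζ := by
    rintro ζ rfl
    have h1 : rowInner (ruelleCoord α A (multSet n) f) (ruelleCoord α B (multSet n') g) ζ =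
        ∑ j ∈ Finset.range (m ζ), ruelleCoord α A (multSet n) f j ζ *
          conj (ruelleCoord α B (multSet n') g j ζ) :=
      tsum_eq_sum fun j hj => by
        rw [ruelleCoord_eq_sum, Finset.sum_eq_zero, zero_mul]
        intro i _
        rw [(hA.row i).support j ζ (not_lt.1 fun h => hj (Finset.mem_range.2 h)), zero_mul]
    rw [h1]
    simp_rw [(hA.row _).rowInner_eq, ruelleCoord_eq_sum, map_sum, Finset.sum_mul_sum,
      Finset.mul_sum]
    rw [Finset.sum_comm]
    refine Finset.sum_congr rfl fun i _ => ?_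
    rw [Finset.sum_comm]
    refine Finset.sum_congr rfl fun k _ => Finset.sum_congr rfl fun j _ => ?_
    rw [map_mul]
    ring
  rw [fiberSum_congr key, fiberSum_eq_sum c, Finset.sum_comm]
  refine Finset.sum_congr rfl fun i _ => ?_
  rw [Finset.sum_comm]
  refine Finset.sum_congr rfl fun k _ => ?_
  rw [rowProduct_eq, fiberSum_eq_sum c, Finset.mul_sum]

lemma sum_enorm_sq_eq {s : Finset ℕ} (z : ℕ → ℂ) :
    ∑ j ∈ s, ‖z j‖ₑ ^ 2 = ENNReal.ofReal (∑ j ∈ s, z j * conj (z j)).re := by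
  rw [Complex.re_sum, ENNReal.ofReal_sum_of_nonneg]
  · refine Finset.sum_congr rfl fun j _ => ?_
    rw [Complex.mul_conj, Complex.ofReal_re, Complex.normSq_eq_norm_sq,
      ENNReal.ofReal_pow (norm_nonneg _), ofReal_norm]
  · intro j _
    rw [Complex.mul_conj, Complex.ofReal_re]
    exact Complex.normSq_nonneg _

lemma IsSupportedRow.tsum_enorm_sq {u : ℕ → PontryaginDual Γ → ℂ} (hu : IsSupportedRow m u)
    (ω : PontryaginDual Γ) :
    ∑' j, ‖u j ω‖ₑ ^ 2 = ENNReal.ofReal (rowInner u u ω).re := by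
  rw [hu.rowInner_eq, ← sum_enorm_sq_eq fun j => u j ω]
  exact tsum_eq_sum fun j hj => by
    rw [hu.support j ω (not_lt.1 fun h => hj (Finset.mem_range.2 h))]; simp

lemma IsSupportedRow.re_rowInner_nonneg {u : ℕ → PontryaginDual Γ → ℂ} (hu : IsSupportedRow m u)
    (ω : PontryaginDual Γ) : 0 ≤ (rowInner u u ω).re := by
  rw [hu.rowInner_eq, Complex.re_sum]
  refine Finset.sum_nonneg fun j _ => ?_
  rw [Complex.mul_conj, Complex.ofReal_re]
  exact Complex.normSq_nonneg _

lemma IsSupportedRow.fiberSum_enorm_sq {u : ℕ → PontryaginDual Γ → ℂ} (c : CrossSection α)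
    (hu : IsSupportedRow m u) (ω : PontryaginDual Γ) :
    fiberSum α (fun ζ => ∑' j, ‖u j ζ‖ₑ ^ 2) ω =
      ENNReal.ofReal (fiberSum α (rowInner u u) ω).re := by
  rw [fiberSum_eq_sum c, fiberSum_eq_sum c, Complex.re_sum,
    ENNReal.ofReal_sum_of_nonneg fun κ _ => hu.re_rowInner_nonneg _]
  exact Finset.sum_congr rfl fun κ _ => hu.tsum_enorm_sq _

/-- Reduces the size of a row, and in particular its vanishing, to the fibres. -/
lemma IsSupportedRow.lintegral_tsum_enorm_sq {u : ℕ → PontryaginDual Γ → ℂ} (c : CrossSection α)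
    (hu : IsSupportedRow m u) :
    α.range.index * ∫⁻ ω, ∑' j, ‖u j ω‖ₑ ^ 2 ∂dualHaar Γ =
      ∫⁻ ω, ENNReal.ofReal (fiberSum α (rowInner u u) ω).re ∂dualHaar Γ := by
  rw [← lintegral_fiberSum c (Measurable.tsum fun j => (hu.measurable j).enorm.pow_const 2)]
  exact lintegral_congr fun ω => hu.fiberSum_enorm_sq c ω

lemma IsRowFilter.norm_ruelleCoord (c : CrossSection α) (hm : Measurable m) (hn : Measurable n)
    (hA : IsRowFilter α m n A) (hf : ∀ i, Measurable (f i)) :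
    ∑' j, ∫⁻ ω, ‖ruelleCoord α A (multSet n) f j ω‖ₑ ^ 2 ∂coreMeasure m j =
      ∑' i, ∫⁻ ω, ‖f i ω‖ₑ ^ 2 ∂(dualHaar Γ).restrict (multSet n i) := by
  have hrow := isSupportedRow_ruelleCoord (α := α) hn hA.supported hf
  have hN0 : (α.range.index : ℝ≥0∞) ≠ 0 :=
    Nat.cast_ne_zero.2 Subgroup.FiniteIndex.index_ne_zero
  -- Both sides are multiplied by `N`: on the left it comes from integrating over fibres, on the
  -- right it will come from the filter equations.
  rw [tsum_setLIntegral_row hm hrow, ← ENNReal.mul_right_inj hN0 (ENNReal.natCast_ne_top _),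
    hrow.lintegral_tsum_enorm_sq c]
  have h1 : ∀ i, ∫⁻ ω, ‖f i ω‖ₑ ^ 2 ∂(dualHaar Γ).restrict (multSet n i) =
      ∫⁻ ω, (multSet n i).indicator (fun ω => ‖f i ω‖ₑ ^ 2) ω ∂dualHaar Γ := fun i =>
    (lintegral_indicator (measurableSet_multSet hn i) _).symm
  simp_rw [h1]
  rw [← lintegral_tsum fun i => (((hf i).enorm.pow_const 2).indicator
      (measurableSet_multSet hn i)).aemeasurable,
    ← lintegral_const_mul _ (Measurable.tsum fun i => ((hf i).enorm.pow_const 2).indicator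
      (measurableSet_multSet hn i))]
  refine lintegral_congr_ae ?_
  filter_upwards [ae_all_iff.2 fun i => ae_all_iff.2 fun i' => hA.filter_eq i i'] with ω hω
  rw [fiberSum_rowInner_ruelleCoord c hA.supported]
  have h2 : ∑ i ∈ Finset.range (n ω), ∑ k ∈ Finset.range (n ω),
      f i ω * conj (f k ω) * rowProduct α A A i k ω =
      ((α.range.index : ℝ) : ℂ) * ∑ i ∈ Finset.range (n ω), f i ω * conj (f i ω) := by
    rw [Finset.mul_sum]
    refine Finset.sum_congr rfl fun i hi => ?_
    rw [Finset.sum_eq_single i]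
    · have : ω ∈ multSet n i := Finset.mem_range.1 hi
      rw [hω, if_pos rfl, Set.indicator_of_mem this, Pi.one_apply, mul_one, mul_comm]
      simp
    · intro k _ hk
      rw [hω, if_neg (Ne.symm hk), mul_zero]
    · exact fun h => absurd hi h
  rw [h2, Complex.re_ofReal_mul, ENNReal.ofReal_mul (Nat.cast_nonneg _), ENNReal.ofReal_natCast,
    ← sum_enorm_sq_eq fun i => f i ω]
  congr 1
  rw [tsum_eq_sum (s := Finset.range (n ω))]
  · refine Finset.sum_congr rfl fun i hi => ?_
    have : ω ∈ multSet n i := Finset.mem_range.1 hi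
    rw [Set.indicator_of_mem this]
  · intro i hi
    have : ω ∉ multSet n i := fun h => hi (Finset.mem_range.2 h)
    rw [Set.indicator_of_notMem this]

/-- The isometry `f ↦ Aᵗ (f ∘ α^*)` defined by a filter. -/
lemma IsRowFilter.exists_linearIsometry (c : CrossSection α) (hm : Measurable m)
    (hn : Measurable n) (hA : IsRowFilter α m n A) {ι : Type*} (e : ℕ ≃ ι)
    (ν : ι → Measure (PontryaginDual Γ))
    (hν : ∀ k, ν (e k) = (dualHaar Γ).restrict (multSet n k)) :
    ∃ S : L2Sum ν →ₗᵢ[ℂ] CoreSpace m, ∀ f j,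
      S f j =ᵐ[coreMeasure m j] ruelleCoord α A (multSet n) (fun k => f (e k)) j := by
  refine L2Sum.exists_linearIsometry
    (fun f j => ruelleCoord α A (multSet n) (fun k => f (e k)) j)
    (fun f g h j => ?_) (fun f g j => ?_) (fun a f j => ?_) (fun f hf j => ?_) (fun f hf => ?_)
  · refine ae_restrict_of_ae ((ruelleCoord_ae_congr c hn fun i => ?_).mono fun ω hω => hω j)
    rw [← hν]
    exact h (e i)
  · refine Filter.Eventually.of_forall fun ω => ?_
    simp only [Pi.add_apply, ruelleCoord_eq_sum, mul_add, Finset.sum_add_distrib]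
  · refine Filter.Eventually.of_forall fun ω => ?_
    simp only [Pi.smul_apply, ruelleCoord_eq_sum, smul_eq_mul, Finset.mul_sum]
    exact Finset.sum_congr rfl fun i _ => by ring
  · exact ((isSupportedRow_ruelleCoord hn hA.supported fun i => hf (e i)).measurable
      j).aestronglyMeasurable
  · rw [hA.norm_ruelleCoord c hm hn fun i => hf (e i), ← e.tsum_eq]
    exact tsum_congr fun k => by rw [hν]

end Ruelle

/-! ## Orthogonal decomposition of the core space -/

section Decomposition

variable {Γ : Type*} [CommGroup Γ] [TopologicalSpace Γ] [DiscreteTopology Γ]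
  {α : Γ →* Γ} [α.range.FiniteIndex] [Countable Γ]
  {m n n' : PontryaginDual Γ → ℕ} {A B : ℕ → ℕ → PontryaginDual Γ → ℂ}
  {ι : Type*} {e : ℕ ≃ ι} {ν : ι → Measure (PontryaginDual Γ)}
  {ι' : Type*} {e' : ℕ ≃ ι'} {ν' : ι' → Measure (PontryaginDual Γ)}

/-- `S` is given by the formula `f ↦ Aᵗ (f ∘ α^*)`. -/
def IsRuelle (α : Γ →* Γ) (n : PontryaginDual Γ → ℕ) (A : ℕ → ℕ → PontryaginDual Γ → ℂ)
    (e : ℕ ≃ ι) (S : L2Sum ν →ₗᵢ[ℂ] CoreSpace m) : Prop :=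
  ∀ f j, S f j =ᵐ[coreMeasure m j] ruelleCoord α A (multSet n) (fun k => f (e k)) j

variable {S : L2Sum ν →ₗᵢ[ℂ] CoreSpace m} {R : L2Sum ν' →ₗᵢ[ℂ] CoreSpace m}

lemma IsRuelle.isRowOf (hS : IsRuelle α n A e S) (f : L2Sum ν) :
    IsRowOf (S f) (ruelleCoord α A (multSet n) fun k => f (e k)) := fun j => (hS f j).symm

lemma IsRuelle.inner_eq_zero (c : CrossSection α) (hm : Measurable m) (hn : Measurable n)
    (hn' : Measurable n') (hA : IsSupportedMatrix m A) (hB : IsSupportedMatrix m B)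
    (hS : IsRuelle α n A e S) (hR : IsRuelle α n' B e' R)
    (h0 : ∀ i k, ∀ᵐ ω ∂dualHaar Γ, rowProduct α A B i k ω = 0) (f : L2Sum ν) (g : L2Sum ν') :
    inner ℂ (R g) (S f) = 0 := by
  refine inner_eq_zero_of_fiberSum_rowInner c hm
    (isSupportedRow_ruelleCoord hn hA fun i => (Lp.stronglyMeasurable (f (e i))).measurable)
    (isSupportedRow_ruelleCoord hn' hB fun i => (Lp.stronglyMeasurable (g (e' i))).measurable)
    (hS.isRowOf f) (hR.isRowOf g) ?_
  filter_upwards [ae_all_iff.2 fun i => ae_all_iff.2 fun k => h0 i k] with ω hω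
  rw [fiberSum_rowInner_ruelleCoord c hA]
  exact Finset.sum_eq_zero fun i _ => Finset.sum_eq_zero fun k _ => by rw [hω, mul_zero]

/-- Composition with `α^*` turns the character `γ` into the character `α γ`. -/
lemma IsRuelle.covariant (c : CrossSection α) (hn : Measurable n)
    (hν : ∀ k, ν (e k) = (dualHaar Γ).restrict (multSet n k)) (hS : IsRuelle α n A e S)
    (γ : Γ) (f : L2Sum ν) :
    S (charSumRep ν γ f) = charSumRep (coreMeasure m) (α γ) (S f) := by
  refine L2Sum.ext_ae fun j => ?_
  have h1 := ruelleCoord_ae_congr (A := A) (f := fun k => charSumRep ν γ f (e k))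
    (g := fun k ω => (ω γ : ℂ) * f (e k) ω) c hn fun i => by
      rw [← hν]; exact charSumRep_coe γ f (e i)
  filter_upwards [hS (charSumRep ν γ f) j, charSumRep_coe (α γ) (S f) j, hS f j,
    ae_restrict_of_ae (s := multSet m j) h1] with ω h2 h3 h4 h5
  rw [h2, h3, h4, h5, ruelleCoord_eq_sum, ruelleCoord_eq_sum, Finset.mul_sum]
  refine Finset.sum_congr rfl fun i _ => ?_
  rw [dualEndo_apply]
  ring

/-- The `i`-th row of `A` restricted to the fibers on which it does not vanish. -/
lemma IsRuelle.isRowOf_single (c : CrossSection α) (hn : Measurable n)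
    (hν : ∀ k, ν (e k) = (dualHaar Γ).restrict (multSet n k)) (hS : IsRuelle α n A e S)
    (i : ℕ) (f : L2Sum ν) (hf : ∀ k, f (e k) =ᵐ[ν (e k)] fun _ => if k = i then 1 else 0) :
    IsRowOf (S f) (ruelleCoord α A (multSet n) fun k _ => if k = i then 1 else 0) := fun j => by
  have h1 := ruelleCoord_ae_congr (A := A) (f := fun k => f (e k))
    (g := fun k _ => if k = i then 1 else 0) c hn fun k => by rw [← hν]; exact hf k
  filter_upwards [hS f j, ae_restrict_of_ae (s := multSet m j) h1] with ω h2 h3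
  rw [h2, h3]

lemma ruelleCoord_single (i j : ℕ) (ω : PontryaginDual Γ) :
    ruelleCoord α A (multSet n) (fun k _ => if k = i then 1 else 0) j ω =
      if i < n (dualEndo α ω) then A i j ω else 0 := by
  rw [ruelleCoord_eq_sum]
  simp

lemma exists_single_coe [∀ a, IsFiniteMeasure (ν a)] (e : ℕ ≃ ι) (i : ℕ) :
    ∃ f : L2Sum ν, ∀ k, f (e k) =ᵐ[ν (e k)] fun _ => if k = i then 1 else 0 := by
  classical
  refine ⟨lp.single 2 (e i) (Lp.const 2 (ν (e i)) (1 : ℂ)), fun k => ?_⟩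
  by_cases h : k = i
  · subst h
    rw [lp.single_apply_self]
    simp only [if_true]
    exact Lp.coeFn_const (p := 2) (μ := ν (e k)) (1 : ℂ)
  · rw [lp.single_apply_ne _ _ _ fun hh => h (e.injective hh)]
    simp only [h, if_false]
    exact Lp.coeFn_zero _ _ _

/-- Orthogonality to the range of `f ↦ Aᵗ (f ∘ α^*)` is fiberwise orthogonality to the rows
of `A`. -/
lemma IsRuelle.fiberSum_eq_zero [∀ a, IsFiniteMeasure (ν a)] (c : CrossSection α)
    (hm : Measurable m) (hn : Measurable n)
    (hν : ∀ k, ν (e k) = (dualHaar Γ).restrict (multSet n k)) (hA : IsSupportedMatrix m A)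
    (hS : IsRuelle α n A e S) {F : CoreSpace m} (hF : ∀ f, inner ℂ (S f) F = 0)
    {u : ℕ → PontryaginDual Γ → ℂ} (hu : IsSupportedRow m u) (huF : IsRowOf F u) :
    ∀ᵐ ω ∂dualHaar Γ, ∀ i < n ω, fiberSum α (rowInner u (A i)) ω = 0 := by
  have h : ∀ i, ∀ᵐ ω ∂dualHaar Γ, i < n ω → fiberSum α (rowInner u (A i)) ω = 0 := fun i => by
    obtain ⟨f, hf⟩ := exists_single_coe (ν := ν) e i
    have h1 := fiberSum_rowInner_ae_eq_zero c hm hu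
      (isSupportedRow_ruelleCoord (α := α) (f := fun k _ => if k = i then 1 else 0) hn hA
        fun k => measurable_const) huF (hS.isRowOf_single c hn hν i f hf) fun γ => by
      -- The range of `S` contains the `α γ⁻¹`-translate of `S f`; unitarity moves this translation
      -- to `F`, as a translation by `α γ`.
      rw [← hF (charSumRep ν γ⁻¹ f), hS.covariant c hn hν,
        ← LinearIsometryEquiv.inner_map_map (charSumRep (coreMeasure m) (α γ⁻¹))]
      congr 1
      change (charSumRep (coreMeasure m) (α γ⁻¹) * charSumRep (coreMeasure m) (α γ)) F = F
      rw [← map_mul, ← map_mul, inv_mul_cancel, map_one, map_one]; rfl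
    filter_upwards [h1] with ω h2 hi
    -- Over a point with `i < n ω`, the cut-off row agrees with the full row `A i` on the whole
    -- fibre.
    refine Eq.trans (fiberSum_congr fun ζ hζ => ?_) h2
    subst hζ
    refine tsum_congr fun j => ?_
    rw [ruelleCoord_single, if_pos hi]
  exact (ae_all_iff.2 h).mono fun ω h i => h i

/-- Orthogonality to both ranges descends to the fibres, where the rows of `H` and `G` span; so
almost every fibre vector of `F` vanishes, and with it the norm of `F`. -/
lemma eq_zero_of_forall_inner_eq_zero [∀ a, IsFiniteMeasure (ν a)] [∀ a, IsFiniteMeasure (ν' a)]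
    (c : CrossSection α) (hm : Measurable m) {H G : ℕ → ℕ → PontryaginDual Γ → ℂ}
    (hH : IsFilter α m H) (hG : IsComplementaryFilter α m H G)
    (hν : ∀ k, ν (e k) = (dualHaar Γ).restrict (multSet m k))
    (hν' : ∀ k, ν' (e' k) = (dualHaar Γ).restrict (multSet (coMultNat α m) k))
    (hS : IsRuelle α m H e S) (hR : IsRuelle α (coMultNat α m) G e' R) {F : CoreSpace m}
    (hF : ∀ f, inner ℂ (S f) F = 0) (hF' : ∀ g, inner ℂ (R g) F = 0) : F = 0 := by
  obtain ⟨u, hu, huF⟩ := exists_isRowOf hm F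
  have h0 : ∫⁻ ω, ENNReal.ofReal (fiberSum α (rowInner u u) ω).re ∂dualHaar Γ = 0 := by
    rw [lintegral_congr_ae (g := 0)]
    · simp
    filter_upwards [hS.fiberSum_eq_zero c hm hm hν hH.supported hF hu huF,
      hR.fiberSum_eq_zero c hm (measurable_coMultNat c hm) hν' hG.supported hF' hu huF,
      fiberVec_eq_zero c hH hG] with ω h1 h2 h3
    have h4 := h3 (fiberVec c m ω u) (fun i hi => by rw [inner_fiberVec c hu, h1 i hi])
      (fun k hk => by rw [inner_fiberVec c hu, h2 k hk])
    rw [← inner_fiberVec c hu, h4, inner_zero_left]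
    simp
  rw [← hu.lintegral_tsum_enorm_sq c, ← huF.enorm_sq hm hu, mul_eq_zero] at h0
  rcases h0 with h0 | h0
  · exact absurd (Nat.cast_eq_zero.1 h0) Subgroup.FiniteIndex.index_ne_zero
  · exact enorm_eq_zero.1 (pow_eq_zero_iff two_ne_zero |>.1 h0)

/-- The diagonal filter equation outside `σ_i` makes a sum of squares over the fibre vanish; the
term at `1` in the kernel is the one at `ω` itself. -/
lemma ae_filter_eq_zero (c : CrossSection α) {H : ℕ → ℕ → PontryaginDual Γ → ℂ}
    (hH : IsFilter α m H) (i j : ℕ) :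
    ∀ᵐ ω ∂dualHaar Γ, m (dualEndo α ω) ≤ i → H i j ω = 0 := by
  filter_upwards [c.measurePreserving.quasiMeasurePreserving.ae (hH.filter_eq i i)] with ω hω hi
  have h1 : dualEndo α ω ∉ multSet m i := not_lt.2 hi
  have h2 : fiberSum α (fun ζ => ∑' j, ‖H i j ζ‖ₑ ^ 2) (dualEndo α ω) = 0 := by
    rw [(hH.supported.row i).fiberSum_enorm_sq c, ← rowProduct_eq, hω, if_pos rfl,
      Set.indicator_of_notMem h1, mul_zero]
    simp
  rw [fiberSum_dualEndo, Finset.sum_eq_zero_iff] at h2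
  have h3 := h2 1 (Finset.mem_univ _)
  rw [OneMemClass.coe_one, mul_one, ENNReal.tsum_eq_zero] at h3
  exact enorm_eq_zero.1 (pow_eq_zero_iff two_ne_zero |>.1 (h3 j))

/-- A covariant isometry whose values at the elements `C_i` are the rows of `H` is
`f ↦ Hᵗ (f ∘ α^*)`. -/
lemma isRuelle_of_covariant (c : CrossSection α) (hm : Measurable m)
    {S : CoreSpace m →ₗᵢ[ℂ] CoreSpace m}
    (hS : ∀ γ f, S (charSumRep (coreMeasure m) γ f) = charSumRep (coreMeasure m) (α γ) (S f))
    {H : ℕ → ℕ → PontryaginDual Γ → ℂ} (hH : IsSupportedMatrix m H)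
    (hrow : ∀ i, IsRowOf (S (coreUnit m i)) (H i)) :
    IsRuelle α m H (Equiv.refl ℕ) S := by
  have hF := isFilter_of_covariant c hm S hS hH hrow
  obtain ⟨S', hS'⟩ := hF.isRowFilter.exists_linearIsometry c hm hm (Equiv.refl ℕ) (coreMeasure m)
    fun k => rfl
  have hS'r : IsRuelle α m H (Equiv.refl ℕ) S' := hS'
  have h1 : ∀ i, S (coreUnit m i) = S' (coreUnit m i) := fun i => by
    refine L2Sum.ext_ae fun j => ?_
    have h2 := hS'r.isRowOf_single c hm (fun k => rfl) i (coreUnit m i) (fun k => by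
      by_cases h : k = i
      · subst h
        simp only [if_true]
        exact coreUnit_coe_self _
      · simp only [h, if_false]
        have : coreUnit m i ((Equiv.refl ℕ) k) = 0 := coreUnit_coe_ne h
        rw [this]
        exact Lp.coeFn_zero _ _ _) j
    -- The operator defined by `H` sends `C_i` to the `i`-th row cut off to the preimage of `σ_i`;
    -- nothing is lost, since the row vanishes elsewhere.
    filter_upwards [hrow i j, h2, ae_restrict_of_ae (s := multSet m j)
      (ae_filter_eq_zero c hF i j)] with ω h3 h4 h5
    rw [← h3, ← h4, ruelleCoord_single]
    split_ifs with h
    · rfl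
    · exact h5 (not_lt.1 h)
  have h2 : S.toContinuousLinearMap = S'.toContinuousLinearMap := by
    refine ContinuousLinearMap.ext_on (dense_span_coreUnit hm) ?_
    rintro _ ⟨⟨γ, i⟩, rfl⟩
    change S (charSumRep (coreMeasure m) γ (coreUnit m i)) =
      S' (charSumRep (coreMeasure m) γ (coreUnit m i))
    rw [hS, hS'r.covariant c hm fun k => rfl, h1]
  have h3 : S = S' := LinearIsometry.ext fun f => DFunLike.congr_fun h2 f
  rw [h3]
  exact hS'r

end Decomposition

/-! ## The dilation of a Hilbert sum -/

section Dilation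

universe u

variable {Γ : Type u} [CommGroup Γ] [TopologicalSpace Γ] [DiscreteTopology Γ]
  {α : Γ →* Γ} [α.range.FiniteIndex] [Countable Γ]
  {ι : Type u} {ν : ι → Measure (PontryaginDual Γ)}

lemma measurableSet_tau (c : CrossSection α) (ζ : (dualEndo α).toMonoidHom.ker) :
    MeasurableSet {ω | c.tau ω = ζ} := by
  have h : {ω | c.tau ω = ζ} =
      (fun ω => c.toFun (dualEndo α ω) * ω⁻¹) ⁻¹' {(ζ : PontryaginDual Γ)} := by
    ext ω
    exact Subtype.ext_iff
  rw [h]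
  exact ((c.measurable_toFun.comp (continuous_dualEndo α).measurable).mul
    measurable_inv) (measurableSet_singleton _)

/-- A point is recovered from its image under `α^*` and its label `τ`; this makes the dilation
invertible. -/
lemma inv_tau_mul (c : CrossSection α) (ω : PontryaginDual Γ) :
    ((c.tau ω : PontryaginDual Γ))⁻¹ * c.toFun (dualEndo α ω) = ω := by
  change (c.toFun (dualEndo α ω) * ω⁻¹)⁻¹ * c.toFun (dualEndo α ω) = ω
  group

/-- The formula for the inverse of the dilation, on families of functions. -/
def undilate (c : CrossSection α)
    (f : ι × (dualEndo α).toMonoidHom.ker → PontryaginDual Γ → ℂ) (a : ι)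
    (ω : PontryaginDual Γ) : ℂ :=
  (Real.sqrt α.range.index : ℂ) * f (a, c.tau ω) (dualEndo α ω)

lemma ae_dilatedMeasure_iff (c : CrossSection α) (a : ι) (ζ : (dualEndo α).toMonoidHom.ker)
    {p : PontryaginDual Γ → Prop} (h : ∀ᵐ ω ∂dilatedMeasure c ν (a, ζ), p ω) :
    ∀ᵐ ω ∂ν a, c.tau ω = ζ → p (dualEndo α ω) := by
  have hN0 : (α.range.index : ℝ≥0∞) ≠ 0 :=
    Nat.cast_ne_zero.2 Subgroup.FiniteIndex.index_ne_zero
  rw [dilatedMeasure, Measure.ae_ennreal_smul_measure_iff hN0] at h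
  have h2 := ae_of_ae_map (continuous_dualEndo α).measurable.aemeasurable h
  exact (ae_restrict_iff' (measurableSet_tau c ζ)).1 h2

lemma undilate_ae_congr (c : CrossSection α)
    {f g : ι × (dualEndo α).toMonoidHom.ker → PontryaginDual Γ → ℂ}
    (h : ∀ p, f p =ᵐ[dilatedMeasure c ν p] g p) (a : ι) :
    undilate c f a =ᵐ[ν a] undilate c g a := by
  filter_upwards [ae_all_iff.2 fun ζ => ae_dilatedMeasure_iff c a ζ (h (a, ζ))] with ω hω
  rw [undilate, undilate, hω _ rfl]

lemma measurable_undilate (c : CrossSection α)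
    {f : ι × (dualEndo α).toMonoidHom.ker → PontryaginDual Γ → ℂ} (hf : ∀ p, Measurable (f p))
    (a : ι) : Measurable (undilate c f a) := by
  classical
  have h : undilate c f a = fun ω => ∑ ζ, {ω | c.tau ω = ζ}.indicator
      (fun ω => (Real.sqrt α.range.index : ℂ) * f (a, ζ) (dualEndo α ω)) ω := by
    ext ω
    rw [Finset.sum_eq_single (c.tau ω)]
    · rw [Set.indicator_of_mem (s := {ω' | c.tau ω' = c.tau ω}) rfl]; rfl
    · intro ζ _ hζ
      exact Set.indicator_of_notMem (s := {ω' | c.tau ω' = ζ}) (fun hh => hζ (Eq.symm hh)) _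
    · exact fun hh => absurd (Finset.mem_univ _) hh
  rw [h]
  exact Finset.measurable_fun_sum _ fun ζ _ =>
    (((hf _).comp (continuous_dualEndo α).measurable).const_mul _).indicator
      (measurableSet_tau c ζ)

/-- The square of `√N` is the factor `N` in the dilated measure, and the pieces `{τ = ζ}` partition
the dual group. -/
lemma lintegral_undilate (c : CrossSection α)
    {f : ι × (dualEndo α).toMonoidHom.ker → PontryaginDual Γ → ℂ} (hf : ∀ p, Measurable (f p)) :
    ∑' a, ∫⁻ ω, ‖undilate c f a ω‖ₑ ^ 2 ∂ν a =
      ∑' p, ∫⁻ ω, ‖f p ω‖ₑ ^ 2 ∂dilatedMeasure c ν p := by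
  classical
  rw [ENNReal.tsum_prod']
  refine tsum_congr fun a => ?_
  have h : ∀ ω, ‖undilate c f a ω‖ₑ ^ 2 = ∑ ζ, {ω | c.tau ω = ζ}.indicator
      (fun ω => (α.range.index : ℝ≥0∞) * ‖f (a, ζ) (dualEndo α ω)‖ₑ ^ 2) ω := fun ω => by
    rw [Finset.sum_eq_single (c.tau ω)]
    · rw [Set.indicator_of_mem (s := {ω' | c.tau ω' = c.tau ω}) rfl, undilate, enorm_mul, mul_pow]
      congr 1
      rw [← ofReal_norm, Complex.norm_real, Real.norm_of_nonneg (Real.sqrt_nonneg _),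
        ← ENNReal.ofReal_pow (Real.sqrt_nonneg _), Real.sq_sqrt (Nat.cast_nonneg _),
        ENNReal.ofReal_natCast]
    · intro ζ _ hζ
      exact Set.indicator_of_notMem (s := {ω' | c.tau ω' = ζ}) (fun hh => hζ (Eq.symm hh)) _
    · exact fun hh => absurd (Finset.mem_univ _) hh
  have hmeas : ∀ ζ, Measurable fun ω => (α.range.index : ℝ≥0∞) * ‖f (a, ζ) (dualEndo α ω)‖ₑ ^ 2 :=
    fun ζ => (((hf _).comp (continuous_dualEndo α).measurable).enorm.pow_const 2).const_mul _
  simp_rw [h]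
  rw [lintegral_finsetSum (f := fun ζ => {ω | c.tau ω = ζ}.indicator
      (fun ω => (α.range.index : ℝ≥0∞) * ‖f (a, ζ) (dualEndo α ω)‖ₑ ^ 2)) _
    fun ζ _ => (hmeas ζ).indicator (measurableSet_tau c ζ), tsum_fintype]
  refine Finset.sum_congr rfl fun ζ _ => ?_
  rw [lintegral_indicator (measurableSet_tau c ζ), dilatedMeasure, lintegral_smul_measure,
    lintegral_map ((hf _).enorm.pow_const 2) (continuous_dualEndo α).measurable,
    lintegral_const_mul (f := fun ω => ‖f (a, ζ) (dualEndo α ω)‖ₑ ^ 2) _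
      (((hf _).comp (continuous_dualEndo α).measurable).enorm.pow_const 2), smul_eq_mul]

/-- The inverse of the dilation is a unitary operator. -/
lemma exists_undilate (c : CrossSection α) (ν : ι → Measure (PontryaginDual Γ)) :
    ∃ D : L2Sum (dilatedMeasure c ν) ≃ₗᵢ[ℂ] L2Sum ν,
      ∀ f a, D f a =ᵐ[ν a] undilate c (fun p => f p) a := by
  obtain ⟨D, hD⟩ := L2Sum.exists_linearIsometry (ν := dilatedMeasure c ν) (ν' := ν) (undilate c)
    (fun f g h a => undilate_ae_congr c h a)
    (fun f g a => Filter.Eventually.of_forall fun ω => by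
      simp only [undilate, Pi.add_apply, mul_add])
    (fun b f a => Filter.Eventually.of_forall fun ω => by
      simp only [undilate, Pi.smul_apply, smul_eq_mul]; ring)
    (fun f hf a => (measurable_undilate c hf a).aestronglyMeasurable)
    (fun f hf => lintegral_undilate c hf)
  have hN0 : (Real.sqrt α.range.index : ℂ) ≠ 0 := by
    rw [Complex.ofReal_ne_zero, Real.sqrt_ne_zero (Nat.cast_nonneg _), Nat.cast_ne_zero]
    exact Subgroup.FiniteIndex.index_ne_zero
  have hsurj : Function.Surjective D := fun g => by
    -- The point `ζ⁻¹ c(ω)` is the one in the fibre over `ω` with `τ = ζ`, so this undoes the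
    -- formula exactly.
    let f : ι × (dualEndo α).toMonoidHom.ker → PontryaginDual Γ → ℂ := fun p ω =>
      (Real.sqrt α.range.index : ℂ)⁻¹ * g p.1 ((p.2 : PontryaginDual Γ)⁻¹ * c.toFun ω)
    have hf : ∀ p, Measurable (f p) := fun p =>
      ((Lp.stronglyMeasurable (g p.1)).measurable.comp
        (c.measurable_toFun.const_mul _)).const_mul _
    have hfg : ∀ a, undilate c f a = g a := fun a => by
      ext ω
      simp only [undilate, f]
      rw [inv_tau_mul, mul_inv_cancel_left₀ hN0]
    obtain ⟨f', hf'⟩ := L2Sum.exists_coe_ae_eq (ν := dilatedMeasure c ν) f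
      (fun p => (hf p).aestronglyMeasurable) (by
        rw [← lintegral_undilate c hf]
        simp_rw [hfg]
        rw [← L2Sum.enorm_sq]
        simp)
    refine ⟨f', L2Sum.ext_ae fun a => ?_⟩
    rw [← hfg]
    exact (hD f' a).trans (undilate_ae_congr c hf' a)
  exact ⟨LinearIsometryEquiv.ofSurjective D hsurj, hD⟩

lemma charSumRep_undilate (c : CrossSection α) {D : L2Sum (dilatedMeasure c ν) ≃ₗᵢ[ℂ] L2Sum ν}
    (hD : ∀ f a, D f a =ᵐ[ν a] undilate c (fun p => f p) a) (γ : Γ)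
    (f : L2Sum (dilatedMeasure c ν)) :
    D (charSumRep (dilatedMeasure c ν) γ f) = charSumRep ν (α γ) (D f) := by
  refine L2Sum.ext_ae fun a => ?_
  have h1 : undilate c (fun p => charSumRep (dilatedMeasure c ν) γ f p) a =ᵐ[ν a]
      undilate c (fun p ω => (ω γ : ℂ) * f p ω) a :=
    undilate_ae_congr c (fun p => charSumRep_coe γ f p) a
  filter_upwards [hD (charSumRep (dilatedMeasure c ν) γ f) a, h1, charSumRep_coe (α γ) (D f) a,
    hD f a] with ω h2 h3 h4 h5
  rw [h2, h3, h4, h5]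
  simp only [undilate, dualEndo_apply]
  ring

end Dilation

/-! ## Equivalence of GMRAs through their core subspaces -/

section AbstractEquivalence

variable {Γ : Type*} [CommGroup Γ]
  {E : Type*} [NormedAddCommGroup E] [InnerProductSpace ℂ E]
  {E' : Type*} [NormedAddCommGroup E'] [InnerProductSpace ℂ E']
  {α : Γ →* Γ} {π : Γ →* (E ≃ₗᵢ[ℂ] E)} {δ : E ≃ₗᵢ[ℂ] E} {V : ℤ → Submodule ℂ E}

lemma IsGMRA.mem_succ_iff (hV : IsGMRA α π δ V) (j : ℤ) (x : E) :
    δ x ∈ V (j + 1) ↔ x ∈ V j := by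
  rw [hV.succ_eq]
  constructor
  · rintro ⟨y, hy, hyx⟩
    rwa [← δ.injective hyx]
  · exact fun h => ⟨x, h, rfl⟩

lemma IsGMRA.pow_inv_mem (hV : IsGMRA α π δ V) (n : ℕ) :
    ∀ x ∈ V n, (δ⁻¹ ^ n) x ∈ V 0 := by
  induction n with
  | zero => exact fun x hx => hx
  | succ n ih =>
    intro x hx
    rw [pow_succ]
    refine ih (δ⁻¹ x) ((hV.mem_succ_iff n _).1 ?_)
    have : δ (δ⁻¹ x) = x := δ.apply_symm_apply x
    rw [this]
    exact_mod_cast hx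

lemma IsGMRA.monotone (hV : IsGMRA α π δ V) : Monotone V :=
  monotone_int_of_le_succ hV.le_succ

/-- By nesting, every `V j` lies in some `V n` with `n` natural, so natural powers of `δ⁻¹` suffice
in later arguments. -/
lemma IsGMRA.dense_setOf (hV : IsGMRA α π δ V) : Dense {x : E | ∃ n : ℕ, (δ⁻¹ ^ n) x ∈ V 0} := by
  refine hV.dense_iUnion.mono ?_
  intro x hx
  obtain ⟨j, hj⟩ := Set.mem_iUnion.1 hx
  exact ⟨j.toNat, hV.pow_inv_mem _ x (hV.monotone (Int.self_le_toNat j) hj)⟩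

lemma zpow_intertwine {U : E → E'} {δ : E ≃ₗᵢ[ℂ] E} {δ' : E' ≃ₗᵢ[ℂ] E'}
    (h : ∀ x, U (δ x) = δ' (U x)) (j : ℤ) (x : E) : U ((δ ^ j) x) = (δ' ^ j) (U x) := by
  have hinv : ∀ x, U (δ⁻¹ x) = δ'⁻¹ (U x) := fun x => by
    have h1 := h (δ⁻¹ x)
    have h2 : δ (δ⁻¹ x) = x := δ.apply_symm_apply x
    rw [h2] at h1
    rw [h1]
    exact (δ'.symm_apply_apply _).symm
  induction j using Int.induction_on generalizing x with
  | zero => rfl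
  | succ n ih =>
    rw [zpow_add_one, zpow_add_one]
    exact (ih (δ x)).trans (by rw [h]; rfl)
  | pred n ih =>
    rw [zpow_sub_one, zpow_sub_one]
    exact (ih (δ⁻¹ x)).trans (by rw [hinv]; rfl)

lemma IsGMRA.mem_iff_zpow (hV : IsGMRA α π δ V) (j : ℤ) (x : E) :
    (δ ^ j) x ∈ V j ↔ x ∈ V 0 := by
  induction j using Int.induction_on generalizing x with
  | zero => rfl
  | succ n ih =>
    rw [add_comm, zpow_one_add, add_comm]
    exact (hV.mem_succ_iff n _).trans (ih x)
  | pred n ih =>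
    rw [← ih, ← hV.mem_succ_iff (-(n : ℤ) - 1)]
    have h : δ ((δ ^ (-(n : ℤ) - 1)) x) = (δ ^ (-(n : ℤ))) x := by
      change (δ * δ ^ (-(n : ℤ) - 1)) x = _
      rw [← zpow_one_add]
      congr 2
      ring
    rw [h, sub_add_cancel]

variable [CompleteSpace E] [CompleteSpace E']

/-- An intertwining isometry of the core subspace extends to a unitary equivalence. -/
lemma IsGMRA.exists_extension (hV : IsGMRA α π δ V) (δ' : E' ≃ₗᵢ[ℂ] E')
    (j : V 0 →ₗᵢ[ℂ] E')
    (h1 : ∀ x : V 0, δ'⁻¹ (j x) = j ⟨δ.symm x, hV.inv_dilation_mem x⟩)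
    (hd : Dense {f : E' | ∃ n : ℕ, ∃ x, j x = (δ'⁻¹ ^ n) f}) :
    ∃ U : E ≃ₗᵢ[ℂ] E', (∀ x : V 0, U x = j x) ∧ ∀ x, U (δ x) = δ' (U x) := by
  have : CompleteSpace (V 0) := (hV.isClosed 0).completeSpace_coe
  -- The map `δ'ⁿ j δ⁻ⁿ` on `V n` is extended to all of `E` by the orthogonal projection onto the
  -- core. This gives contractions on one domain, which stabilise on each vector of `⋃ V n`.
  let A : ℕ → E →ₗ[ℂ] E' := fun n => (δ' ^ n).toLinearEquiv.toLinearMap ∘ₗ j.toLinearMap ∘ₗ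
    ((V 0).orthogonalProjectionOnto : E →L[ℂ] V 0).toLinearMap ∘ₗ (δ⁻¹ ^ n).toLinearEquiv.toLinearMap
  have hA : ∀ n x, A n x = (δ' ^ n) (j ((V 0).orthogonalProjectionOnto ((δ⁻¹ ^ n) x))) :=
    fun n x => rfl
  have hnorm : ∀ n x, ‖A n x‖ ≤ ‖x‖ := fun n x => by
    rw [hA, LinearIsometryEquiv.norm_map, LinearIsometry.norm_map]
    refine ((V 0).norm_orthogonalProjectionOnto_apply_le _).trans ?_
    rw [LinearIsometryEquiv.norm_map]
  have hstep : ∀ n x, (δ⁻¹ ^ n) x ∈ V 0 → (δ⁻¹ ^ (n + 1)) x ∈ V 0 ∧ A (n + 1) x = A n x := by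
    intro n x hx
    have h2 : (δ⁻¹ ^ (n + 1)) x = δ.symm ((δ⁻¹ ^ n) x) := by rw [pow_succ']; rfl
    have hx' : (δ⁻¹ ^ (n + 1)) x ∈ V 0 := h2 ▸ hV.inv_dilation_mem ⟨_, hx⟩
    refine ⟨hx', ?_⟩
    have h3 : j ((V 0).orthogonalProjectionOnto ((δ⁻¹ ^ (n + 1)) x)) =
        δ'⁻¹ (j ((V 0).orthogonalProjectionOnto ((δ⁻¹ ^ n) x))) := by
      have e1 := (V 0).orthogonalProjectionOnto_mem_subspace_eq_self ⟨_, hx'⟩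
      have e2 := (V 0).orthogonalProjectionOnto_mem_subspace_eq_self ⟨_, hx⟩
      rw [e1, e2, h1]
      congr 1
      exact Subtype.ext h2
    rw [hA, hA, h3, pow_succ]
    change (δ' ^ n) (δ' (δ'.symm _)) = _
    rw [δ'.apply_symm_apply]
  have hstable : ∀ k x, (δ⁻¹ ^ k) x ∈ V 0 → ∀ n, k ≤ n → A n x = A k x := by
    intro k x hx n hn
    have : (δ⁻¹ ^ n) x ∈ V 0 ∧ A n x = A k x := by
      induction n, hn using Nat.le_induction with
      | base => exact ⟨hx, rfl⟩
      | succ n _ ih => exact ⟨(hstep n x ih.1).1, (hstep n x ih.1).2.trans ih.2⟩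
    exact this.2
  -- Contractions that are eventually constant on a dense set converge strongly.
  have hcauchy : ∀ x, CauchySeq fun n => A n x := by
    intro x
    rw [Metric.cauchySeq_iff']
    intro ε hε
    obtain ⟨y, hy, k, hk⟩ := Metric.dense_iff.1 hV.dense_setOf x (ε / 3) (by positivity)
    refine ⟨k, fun n hn => ?_⟩
    have hxy : ‖x - y‖ < ε / 3 := by rw [← dist_eq_norm, dist_comm]; exact hy
    have h3 : A n x - A k x = A n (x - y) - A k (x - y) := by
      rw [map_sub, map_sub, hstable k y hk n hn]; abel
    rw [dist_eq_norm, h3]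
    calc ‖A n (x - y) - A k (x - y)‖ ≤ ‖A n (x - y)‖ + ‖A k (x - y)‖ := norm_sub_le _ _
      _ ≤ ‖x - y‖ + ‖x - y‖ := add_le_add (hnorm _ _) (hnorm _ _)
      _ < ε := by linarith
  choose L hL using fun x => cauchySeq_tendsto_of_complete (hcauchy x)
  have hLk : ∀ k x, (δ⁻¹ ^ k) x ∈ V 0 → L x = A k x := fun k x hx =>
    tendsto_nhds_unique (hL x) (tendsto_const_nhds.congr' (by
      filter_upwards [Filter.eventually_ge_atTop k] with n hn
      exact (hstable k x hx n hn).symm))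
  have hLδ : ∀ x, L (δ x) = δ' (L x) := fun x => by
    have t1 := (hL (δ x)).comp (Filter.tendsto_add_atTop_nat 1)
    have t2 := (δ'.continuous.tendsto _).comp (hL x)
    -- The index shifts by one: `A (n + 1) (δ x) = δ' (A n x)`.
    refine tendsto_nhds_unique t1 (t2.congr fun n => ?_)
    simp only [Function.comp_apply, hA]
    rw [pow_succ' δ' n, pow_succ δ⁻¹ n]
    change δ' _ = δ' ((δ' ^ n) (j ((V 0).orthogonalProjectionOnto ((δ⁻¹ ^ n) (δ.symm (δ x))))))
    rw [δ.symm_apply_apply]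
  let U0 : E →ₗ[ℂ] E' := linearMapOfTendsto L A (tendsto_pi_nhds.2 hL)
  have hU0 : ∀ x, U0 x = L x := fun x => rfl
  have hle : ∀ x, ‖U0 x‖ ≤ ‖x‖ := fun x =>
    le_of_tendsto (hL x).norm (Filter.Eventually.of_forall fun n => hnorm n x)
  let U1 : E →L[ℂ] E' := U0.mkContinuous 1 fun x => by rw [one_mul]; exact hle x
  have hU1 : ∀ x, U1 x = L x := fun x => rfl
  have heq : ∀ x, ‖U1 x‖ = ‖x‖ := by
    have hcl : IsClosed {x | ‖U1 x‖ = ‖x‖} := isClosed_eq U1.continuous.norm continuous_norm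
    intro x
    refine closure_minimal ?_ hcl (hV.dense_setOf x)
    rintro y ⟨k, hk⟩
    change ‖U1 y‖ = ‖y‖
    have e2 := (V 0).orthogonalProjectionOnto_mem_subspace_eq_self ⟨_, hk⟩
    rw [hU1, hLk k y hk, hA, LinearIsometryEquiv.norm_map, LinearIsometry.norm_map, e2]
    exact (δ⁻¹ ^ k).norm_map y
  let U2 : E →ₗᵢ[ℂ] E' := ⟨U1.toLinearMap, heq⟩
  have hU2 : ∀ x, U2 x = L x := fun x => rfl
  have hU2δ : ∀ x, U2 (δ x) = δ' (U2 x) := hLδ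
  have hU2j : ∀ x : V 0, U2 x = j x := fun x => by
    rw [hU2, hLk 0 x x.2, hA, pow_zero, pow_zero]
    change j ((V 0).orthogonalProjectionOnto (x : E)) = j x
    rw [(V 0).orthogonalProjectionOnto_mem_subspace_eq_self]
  -- The range of an isometry of a complete space is closed, and by `hd` it contains a dense set.
  have hsurj : Function.Surjective U2 := by
    have hcl : IsClosed (Set.range U2) := U2.isometry.isClosedEmbedding.isClosed_range
    intro f
    refine closure_minimal ?_ hcl (hd f)
    rintro g ⟨n, x, hx⟩
    refine ⟨(δ ^ n) x, ?_⟩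
    have h3 := zpow_intertwine hU2δ n (x : E)
    rw [zpow_natCast, zpow_natCast] at h3
    rw [h3, hU2j, hx]
    change (δ' ^ n * δ'⁻¹ ^ n) g = g
    rw [inv_pow, mul_inv_cancel]
    rfl
  exact ⟨LinearIsometryEquiv.ofSurjective U2 hsurj, hU2j, hU2δ⟩

/-- A unitary operator which agrees with an intertwiner on the core and intertwines the dilations
intertwines the representations. -/
lemma IsGMRA.extension_intertwines (hV : IsGMRA α π δ V) {δ' : E' ≃ₗᵢ[ℂ] E'}
    {π' : Γ →* (E' ≃ₗᵢ[ℂ] E')} {U : E ≃ₗᵢ[ℂ] E'}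
    (h0 : ∀ γ, ∀ x ∈ V 0, U (π γ x) = π' γ (U x)) (hδ : ∀ x, U (δ x) = δ' (U x))
    (h3 : ∀ γ f, δ'⁻¹ (π' γ f) = π' (α γ) (δ'⁻¹ f)) (γ : Γ) (x : E) :
    U (π γ x) = π' γ (U x) := by
  -- Passing `δ` changes `γ` to `α γ`, so the induction must carry all `γ` at once.
  have hstep : ∀ x, (∀ γ, U (π γ x) = π' γ (U x)) → ∀ γ, U (π γ (δ x)) = π' γ (U (δ x)) := by
    intro x hx γ
    have h1 : π γ (δ x) = δ (π (α γ) x) := by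
      have h2 := DFunLike.congr_fun (hV.conj_dilation γ) x
      rw [← h2]
      exact (δ.apply_symm_apply _).symm
    have h4 : π' γ (δ' (U x)) = δ' (π' (α γ) (U x)) := by
      have h5 := h3 γ (δ' (U x))
      have h6 : δ'⁻¹ (δ' (U x)) = U x := δ'.symm_apply_apply _
      rw [h6] at h5
      rw [← h5]
      exact (δ'.apply_symm_apply _).symm
    rw [h1, hδ, hx, hδ, h4]
  have hcl : IsClosed {x | U (π γ x) = π' γ (U x)} :=
    isClosed_eq (U.continuous.comp (π γ).continuous) ((π' γ).continuous.comp U.continuous)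
  refine closure_minimal ?_ hcl (hV.dense_setOf x)
  rintro y ⟨n, hn⟩
  have hpow : ∀ n : ℕ, ∀ z ∈ V 0, ∀ γ, U (π γ ((δ ^ n) z)) = π' γ (U ((δ ^ n) z)) := by
    intro n
    induction n with
    | zero => exact fun z hz γ => h0 γ z hz
    | succ n ih =>
      intro z hz
      rw [pow_succ']
      exact hstep _ (ih z hz)
  have h5 := hpow n _ hn γ
  have h6 : (δ ^ n) ((δ⁻¹ ^ n) y) = y := by
    change (δ ^ n * δ⁻¹ ^ n) y = y
    rw [inv_pow, mul_inv_cancel]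
    rfl
  rw [h6] at h5
  exact h5

/-- A system of subspaces which is unitarily equivalent to a GMRA is a GMRA. -/
lemma IsGMRA.transport (hV : IsGMRA α π δ V) {δ' : E' ≃ₗᵢ[ℂ] E'}
    {π' : Γ →* (E' ≃ₗᵢ[ℂ] E')} {V' : ℤ → Submodule ℂ E'} (U : E ≃ₗᵢ[ℂ] E')
    (hU : ∀ j, (V j).map U.toLinearEquiv.toLinearMap = V' j)
    (hπ : ∀ γ f, U (π γ f) = π' γ (U f)) (hδ : ∀ f, U (δ f) = δ' (U f))
    (h3 : ∀ γ f, δ'⁻¹ (π' γ f) = π' (α γ) (δ'⁻¹ f)) : IsGMRA α π' δ' V' := by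
  have hmem : ∀ j x, U x ∈ V' j ↔ x ∈ V j := fun j x => by
    rw [← hU]
    constructor
    · rintro ⟨y, hy, hyx⟩
      rwa [← U.injective hyx]
    · exact fun h => ⟨x, h, rfl⟩
  have himage : ∀ j, (V' j : Set E') = U '' (V j : Set E) := fun j => by
    rw [← hU]; rfl
  refine ⟨fun γ => LinearIsometryEquiv.ext fun f => ?_, fun j => ?_, fun j => ?_, fun j => ?_,
    ?_, ?_, fun γ f hf => ?_⟩
  · change δ'⁻¹ (π' γ (δ' f)) = π' (α γ) f
    rw [h3]
    exact congrArg _ (δ'.symm_apply_apply f)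
  · rw [himage]
    exact U.toHomeomorph.isClosedMap _ (hV.isClosed j)
  · rw [← hU, ← hU]
    exact Submodule.map_mono (hV.le_succ j)
  · rw [← hU, ← hU, hV.succ_eq, ← Submodule.map_comp, ← Submodule.map_comp]
    congr 1
    ext x
    exact hδ x
  · rw [Submodule.eq_bot_iff]
    intro f hf
    obtain ⟨x, rfl⟩ := U.surjective f
    have hx : x ∈ ⨅ j, V j :=
      (Submodule.mem_iInf _).2 fun j => (hmem j x).1 ((Submodule.mem_iInf _).1 hf j)
    rw [hV.iInf_eq_bot, Submodule.mem_bot] at hx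
    rw [hx, map_zero]
  · simp_rw [himage, ← Set.image_iUnion]
    exact U.surjective.denseRange.dense_image U.continuous hV.dense_iUnion
  · obtain ⟨x, rfl⟩ := U.surjective f
    rw [← hπ, hmem]
    exact hV.invariant γ x ((hmem 0 x).1 hf)

/-- A GMRA is equivalent to the system generated by a copy of its core subspace. -/
theorem IsGMRA.equivalent_of_core (hV : IsGMRA α π δ V) (T : E' ≃ₗᵢ[ℂ] E')
    (π' : Γ →* (E' ≃ₗᵢ[ℂ] E')) (K : Submodule ℂ E') (j : V 0 →ₗᵢ[ℂ] E')
    (hj : LinearMap.range j.toLinearMap = K)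
    (h1 : ∀ x : V 0, T (j x) = j ⟨δ.symm x, hV.inv_dilation_mem x⟩)
    (h2 : ∀ γ, ∀ x : V 0, j ⟨π γ x, hV.invariant γ x x.2⟩ = π' γ (j x))
    (h3 : ∀ γ f, T (π' γ f) = π' (α γ) (T f))
    (hd : Dense {f : E' | ∃ n : ℕ, (T ^ n) f ∈ K}) :
    IsGMRA α π' T⁻¹ (fun i => K.map (T ^ (-i)).toLinearEquiv.toLinearMap) ∧
    GMRAEquivalent π δ V π' T⁻¹ (fun i => K.map (T ^ (-i)).toLinearEquiv.toLinearMap) := by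
  obtain ⟨U, hUj, hUδ⟩ := hV.exists_extension T⁻¹ j (fun x => by rw [inv_inv, h1]) (by
    refine hd.mono ?_
    rintro f ⟨n, hn⟩
    rw [← hj] at hn
    obtain ⟨x, hx⟩ := hn
    exact ⟨n, x, by rw [inv_inv]; exact hx⟩)
  have h3' : ∀ γ f, (T⁻¹)⁻¹ (π' γ f) = π' (α γ) ((T⁻¹)⁻¹ f) := by rwa [inv_inv]
  have hUπ := hV.extension_intertwines (π' := π') (U := U) (δ' := T⁻¹) (fun γ x hx => by
    have e1 := hUj ⟨π γ x, hV.invariant γ x hx⟩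
    have e2 := hUj ⟨x, hx⟩
    simp only at e1 e2
    rw [e1, e2]
    exact h2 γ ⟨x, hx⟩) hUδ h3'
  have hmap : ∀ i, (V i).map U.toLinearEquiv.toLinearMap =
      K.map (T ^ (-i)).toLinearEquiv.toLinearMap := fun i => by
    have hz : ∀ x, U ((δ ^ i) x) = (T ^ (-i)) (U x) := fun x => by
      rw [zpow_intertwine hUδ, inv_zpow']
    ext f
    constructor
    · rintro ⟨x, hx, rfl⟩
      have hx' : (δ ^ i) ((δ ^ i)⁻¹ x) = x := (δ ^ i).apply_symm_apply x
      have hy : (δ ^ i)⁻¹ x ∈ V 0 := (hV.mem_iff_zpow i _).1 (by rw [hx']; exact hx)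
      refine ⟨U ((δ ^ i)⁻¹ x), ?_, ?_⟩
      · rw [← hj]
        exact ⟨⟨_, hy⟩, (hUj ⟨_, hy⟩).symm⟩
      · change (T ^ (-i)) (U ((δ ^ i)⁻¹ x)) = U x
        rw [← hz, hx']
    · rintro ⟨g, hg, rfl⟩
      rw [← hj] at hg
      obtain ⟨x, rfl⟩ := hg
      refine ⟨(δ ^ i) x, (hV.mem_iff_zpow i _).2 x.2, ?_⟩
      change U ((δ ^ i) x) = (T ^ (-i)) (j x)
      rw [hz, hUj]
  exact ⟨hV.transport U hmap hUπ hUδ h3', U, hmap, hUπ, hUδ⟩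

end AbstractEquivalence

/-! ## Unitary operators of shift type -/

section Shift

variable {K : Type*} [NormedAddCommGroup K] [InnerProductSpace ℂ K] [CompleteSpace K]
  {W : ℕ → Type*} [∀ n, NormedAddCommGroup (W n)] [∀ n, InnerProductSpace ℂ (W n)]
  [∀ n, CompleteSpace (W n)]

lemma exists_add_eq_of_orthogonal {F F' : Type*} [NormedAddCommGroup F] [InnerProductSpace ℂ F]
    [CompleteSpace F] [NormedAddCommGroup F'] [InnerProductSpace ℂ F'] [CompleteSpace F']
    (S : F →ₗᵢ[ℂ] K) (R : F' →ₗᵢ[ℂ] K) (horth : ∀ f g, inner ℂ (R g) (S f) = 0)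
    (htot : ∀ x, (∀ f, inner ℂ (S f) x = 0) → (∀ g, inner ℂ (R g) x = 0) → x = 0) (x : K) :
    ∃ f g, S f + R g = x := by
  have hS : CompleteSpace (LinearMap.range S.toLinearMap) :=
    (S.isometry.isClosedEmbedding.isClosed_range).completeSpace_coe
  have hR : CompleteSpace (LinearMap.range R.toLinearMap) :=
    (R.isometry.isClosedEmbedding.isClosed_range).completeSpace_coe
  obtain ⟨y, ⟨f, rfl⟩, z, hz, hx⟩ :=
    (LinearMap.range S.toLinearMap).exists_add_mem_mem_orthogonal x
  obtain ⟨y', ⟨g, rfl⟩, z', hz', hx'⟩ :=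
    (LinearMap.range R.toLinearMap).exists_add_mem_mem_orthogonal x
  refine ⟨f, g, ?_⟩
  -- With `S f` and `R g` the projections of `x` onto the two ranges, orthogonality of the ranges
  -- makes the remainder orthogonal to both.
  have h0 := htot (x - (S f + R g)) (fun f' => by
    have e : x - (S f + R g) = z - R g := by
      rw [hx]; change S f + z - (S f + R g) = z - R g; abel
    rw [e, inner_sub_right, inner_eq_zero_symm.1 (horth f' g), sub_zero]
    exact (Submodule.mem_orthogonal _ _).1 hz _ ⟨f', rfl⟩) (fun g' => by
    have e : x - (S f + R g) = z' - S f := by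
      rw [hx']; change R g + z' - (S f + R g) = z' - S f; abel
    rw [e, inner_sub_right, horth f g', sub_zero]
    exact (Submodule.mem_orthogonal _ _).1 hz' _ ⟨g', rfl⟩)
  exact (sub_eq_zero.1 h0).symm

/-- The formula for an operator of shift type. -/
structure IsShiftType (S : K →ₗᵢ[ℂ] K) (R : W 0 →ₗᵢ[ℂ] K) (D : ∀ n, W (n + 1) ≃ₗᵢ[ℂ] W n)
    (T : WithLp 2 (K × lp W 2) ≃ₗᵢ[ℂ] WithLp 2 (K × lp W 2)) : Prop where
  fst : ∀ f, (T f).fst = S f.fst + R (f.snd 0)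
  snd : ∀ f n, (T f).snd n = D n (f.snd (n + 1))

lemma withLp_prod_enorm_sq {F F' : Type*} [NormedAddCommGroup F] [NormedAddCommGroup F']
    (f : WithLp 2 (F × F')) : ‖f‖ₑ ^ 2 = ‖f.fst‖ₑ ^ 2 + ‖f.snd‖ₑ ^ 2 := by
  simp_rw [← ofReal_norm, ← ENNReal.ofReal_pow (norm_nonneg _)]
  rw [← ENNReal.ofReal_add (sq_nonneg _) (sq_nonneg _), WithLp.prod_norm_sq_eq_of_L2]

/-- `S` and `R` together map `K ⊕ W 0` unitarily onto `K`, while the `D n` map each remaining layer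
onto the one before it. -/
lemma exists_isShiftType (S : K →ₗᵢ[ℂ] K) (R : W 0 →ₗᵢ[ℂ] K)
    (horth : ∀ f g, inner ℂ (R g) (S f) = 0)
    (htot : ∀ x, (∀ f, inner ℂ (S f) x = 0) → (∀ g, inner ℂ (R g) x = 0) → x = 0)
    (D : ∀ n, W (n + 1) ≃ₗᵢ[ℂ] W n) : ∃ T, IsShiftType S R D T := by
  have htail : ∀ g : lp W 2, ∑' n, ‖D n (g (n + 1))‖ₑ ^ 2 = ∑' n, ‖g (n + 1)‖ₑ ^ 2 := fun g =>
    tsum_congr fun n => by rw [LinearIsometryEquiv.enorm_map]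
  have hsplit : ∀ g : lp W 2, ‖g‖ₑ ^ 2 = ‖g 0‖ₑ ^ 2 + ∑' n, ‖g (n + 1)‖ₑ ^ 2 := fun g => by
    rw [lp_enorm_sq, tsum_eq_zero_add' ENNReal.summable]
  have hmem : ∀ g : lp W 2, Memℓp (fun n => D n (g (n + 1))) 2 := fun g =>
    memℓp_two_of_tsum_enorm_sq (by
      rw [htail]
      refine ne_top_of_le_ne_top (b := ‖g‖ₑ ^ 2) (by simp) ?_
      rw [hsplit]
      exact le_add_self)
  have hpyth : ∀ f g, ‖S f + R g‖ₑ ^ 2 = ‖f‖ₑ ^ 2 + ‖g‖ₑ ^ 2 := fun f g => by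
    simp_rw [← ofReal_norm, ← ENNReal.ofReal_pow (norm_nonneg _)]
    rw [← ENNReal.ofReal_add (sq_nonneg _) (sq_nonneg _), sq, sq, sq,
      norm_add_sq_eq_norm_sq_add_norm_sq_of_inner_eq_zero _ _ (inner_eq_zero_symm.1 (horth f g)),
      S.norm_map, R.norm_map]
  let T0 : WithLp 2 (K × lp W 2) →ₗᵢ[ℂ] WithLp 2 (K × lp W 2) :=
    { toFun := fun f => WithLp.toLp 2 (S f.fst + R (f.snd 0), ⟨fun n => D n (f.snd (n + 1)), hmem _⟩)
      map_add' := fun f g => by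
        refine (WithLp.ofLp_injective 2) (Prod.ext ?_ (lp.ext (funext fun n => ?_)))
        · change S (f.fst + g.fst) + R (f.snd 0 + g.snd 0) =
            (S f.fst + R (f.snd 0)) + (S g.fst + R (g.snd 0))
          rw [map_add, map_add]; abel
        · exact map_add (D n) (f.snd (n + 1)) (g.snd (n + 1))
      map_smul' := fun a f => by
        refine (WithLp.ofLp_injective 2) (Prod.ext ?_ (lp.ext (funext fun n => ?_)))
        · change S (a • f.fst) + R (a • f.snd 0) = a • (S f.fst + R (f.snd 0))
          rw [map_smul, map_smul, smul_add]
        · exact map_smul (D n) a (f.snd (n + 1))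
      norm_map' := fun f => by
        have h : ‖(WithLp.toLp 2 (S f.fst + R (f.snd 0),
            (⟨fun n => D n (f.snd (n + 1)), hmem _⟩ : lp W 2)) :
            WithLp 2 (K × lp W 2))‖ₑ ^ 2 = ‖f‖ₑ ^ 2 := by
          rw [withLp_prod_enorm_sq, withLp_prod_enorm_sq, hsplit f.snd, lp_enorm_sq]
          change ‖S f.fst + R (f.snd 0)‖ₑ ^ 2 + ∑' n, ‖D n (f.snd (n + 1))‖ₑ ^ 2 = _
          rw [hpyth, htail, add_assoc]
        exact congrArg ENNReal.toReal ((ENNReal.pow_right_strictMono two_ne_zero).injective h) }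
  have hsurj : Function.Surjective T0 := fun f => by
    obtain ⟨a, b, hab⟩ := exists_add_eq_of_orthogonal S R horth htot f.fst
    let g : ∀ n, W n := fun n => match n with
      | 0 => b
      | n + 1 => (D n).symm (f.snd n)
    have hg : Memℓp g 2 := memℓp_two_of_tsum_enorm_sq (by
      rw [tsum_eq_zero_add' ENNReal.summable]
      have h1 : ∑' n, ‖g (n + 1)‖ₑ ^ 2 = ‖f.snd‖ₑ ^ 2 := by
        rw [lp_enorm_sq]
        exact tsum_congr fun n => congrArg (· ^ 2) ((D n).symm.enorm_map (f.snd n))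
      rw [h1]
      simp)
    refine ⟨WithLp.toLp 2 (a, ⟨g, hg⟩), (WithLp.ofLp_injective 2) (Prod.ext hab ?_)⟩
    exact lp.ext (funext fun n => (D n).apply_symm_apply (f.snd n))
  exact ⟨LinearIsometryEquiv.ofSurjective T0 hsurj, fun f => rfl, fun f n => rfl⟩

variable {S : K →ₗᵢ[ℂ] K} {R : W 0 →ₗᵢ[ℂ] K} {D : ∀ n, W (n + 1) ≃ₗᵢ[ℂ] W n}
  {T : WithLp 2 (K × lp W 2) ≃ₗᵢ[ℂ] WithLp 2 (K × lp W 2)}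

/-- Each application of `T` moves every layer one step toward the core, which absorbs `W 0`. -/
lemma IsShiftType.pow_snd_eq_zero (hT : IsShiftType S R D T) (k : ℕ) :
    ∀ f, (∀ n, k ≤ n → f.snd n = 0) → ((T ^ k) f).snd = 0 := by
  induction k with
  | zero => exact fun f hf => lp.ext (funext fun n => hf n (Nat.zero_le n))
  | succ k ih =>
    intro f hf
    rw [pow_succ]
    refine ih (T f) fun n hn => ?_
    rw [hT.snd, hf _ (Nat.succ_le_succ hn), map_zero]

/-- Truncations to the first `k` layers converge to `f`, and `T ^ k` sends them into the core. -/
lemma IsShiftType.dense (hT : IsShiftType S R D T) :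
    Dense {f : WithLp 2 (K × lp W 2) | ∃ k : ℕ, ((T ^ k) f).snd = 0} := by
  classical
  intro f
  let p : ℕ → WithLp 2 (K × lp W 2) := fun k =>
    WithLp.toLp 2 (f.fst, ∑ n ∈ Finset.range k, lp.single 2 n (f.snd n))
  have hp : ∀ k, ((T ^ k) (p k)).snd = 0 := fun k => hT.pow_snd_eq_zero k _ fun n hn => by
    change (∑ i ∈ Finset.range k, lp.single 2 i (f.snd i) : lp W 2) n = 0
    rw [lp.coeFn_sum, Finset.sum_apply]
    refine Finset.sum_eq_zero fun i hi => lp.single_apply_ne _ _ _ ?_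
    have := Finset.mem_range.1 hi
    omega
  have hlim : Filter.Tendsto p Filter.atTop (nhds f) := by
    have h1 := (lp.hasSum_single (p := 2) (by norm_num) f.snd).tendsto_sum_nat
    have h2 := (WithLp.prod_continuous_toLp 2 K (lp W 2)).tendsto (f.fst, f.snd)
    exact h2.comp (tendsto_const_nhds.prodMk_nhds h1)
  exact mem_closure_of_tendsto hlim (Filter.Eventually.of_forall fun k => ⟨k, hp k⟩)

end Shift

/-! ## The canonical GMRA -/

section CanonicalGMRA

universe u

variable {Γ : Type u} [CommGroup Γ] [TopologicalSpace Γ] [DiscreteTopology Γ]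
  {α : Γ →* Γ} {m : PontryaginDual Γ → ℕ}

/-- The action of the inverse dilation on `⨁ᵢ L²(σ_i)` through `J`. -/
def coreIsometry {E : Type*} [NormedAddCommGroup E] [InnerProductSpace ℂ E]
    {π : Γ →* (E ≃ₗᵢ[ℂ] E)} {δ : E ≃ₗᵢ[ℂ] E} {V : ℤ → Submodule ℂ E} (hV : IsGMRA α π δ V)
    (J : V 0 ≃ₗᵢ[ℂ] CoreSpace m) : CoreSpace m →ₗᵢ[ℂ] CoreSpace m where
  toFun f := J ⟨δ.symm (J.symm f : E), hV.inv_dilation_mem (J.symm f)⟩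
  map_add' f g := by
    rw [← map_add]
    congr 1
    apply Subtype.ext
    change δ.symm (J.symm (f + g) : E) = δ.symm (J.symm f : E) + δ.symm (J.symm g : E)
    rw [map_add, Submodule.coe_add, map_add]
  map_smul' a f := by
    rw [RingHom.id_apply, ← map_smul]
    congr 1
    apply Subtype.ext
    change δ.symm (J.symm (a • f) : E) = a • δ.symm (J.symm f : E)
    rw [map_smul, Submodule.coe_smul, map_smul]
  norm_map' f := by
    change ‖J ⟨δ.symm (J.symm f : E), hV.inv_dilation_mem (J.symm f)⟩‖ = ‖f‖
    rw [J.norm_map, Submodule.coe_norm, δ.symm.norm_map, ← Submodule.coe_norm, J.symm.norm_map]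

section

variable {E : Type*} [NormedAddCommGroup E] [InnerProductSpace ℂ E]
    {π : Γ →* (E ≃ₗᵢ[ℂ] E)} {δ : E ≃ₗᵢ[ℂ] E} {V : ℤ → Submodule ℂ E} {hV : IsGMRA α π δ V}
    {J : V 0 ≃ₗᵢ[ℂ] CoreSpace m}

lemma IsGMRA.symm_rep (hV : IsGMRA α π δ V) (γ : Γ) (x : E) :
    δ.symm (π γ x) = π (α γ) (δ.symm x) := by
  rw [← hV.conj_dilation γ]
  change δ.symm (π γ x) = δ.symm (π γ (δ (δ.symm x)))
  rw [δ.apply_symm_apply]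

lemma IsStoneMap.symm_apply (hJ : IsStoneMap hV m J) (γ : Γ) (f : CoreSpace m) :
    (J.symm (charSumRep (coreMeasure m) γ f) : E) = π γ (J.symm f) := by
  have h := hJ γ (J.symm f)
  rw [J.apply_symm_apply] at h
  rw [← h, J.symm_apply_apply]

lemma coreIsometry_covariant (hJ : IsStoneMap hV m J) (γ : Γ) (f : CoreSpace m) :
    coreIsometry hV J (charSumRep (coreMeasure m) γ f) =
      charSumRep (coreMeasure m) (α γ) (coreIsometry hV J f) := by
  have h := hJ (α γ) ⟨δ.symm (J.symm f : E), hV.inv_dilation_mem (J.symm f)⟩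
  refine Eq.trans ?_ h
  refine congrArg J (Subtype.ext ?_)
  change δ.symm (J.symm (charSumRep (coreMeasure m) γ f) : E) = π (α γ) (δ.symm (J.symm f : E))
  rw [hJ.symm_apply, hV.symm_rep]

lemma IsConstructedFilter.isRowOf {H : ℕ → ℕ → PontryaginDual Γ → ℂ}
    (hH : IsConstructedFilter hV m J H) (i : ℕ) :
    IsRowOf (coreIsometry hV J (coreUnit m i)) (H i) :=
  fun j => hH.row_eq i j

end

variable [α.range.FiniteIndex] [Countable Γ]

instance wMeasure_zero_isFinite (c : CrossSection α) (m : PontryaginDual Γ → ℕ)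
    (a : WIndex α 0) : IsFiniteMeasure (wMeasure c m 0 a) := by
  change IsFiniteMeasure ((dualHaar Γ).restrict _)
  infer_instance

/-- The numbering of the summands of `𝓦_0`. -/
def wIndexEquiv (α : Γ →* Γ) : ℕ ≃ WIndex α 0 := Equiv.ulift.{u}.symm

lemma wMeasure_zero (c : CrossSection α) (m : PontryaginDual Γ → ℕ) (k : ℕ) :
    wMeasure c m 0 (wIndexEquiv α k) = (dualHaar Γ).restrict (multSet (coMultNat α m) k) := by
  rw [← coMultSet_eq]
  rfl

lemma exists_wUndilate (c : CrossSection α) (m : PontryaginDual Γ → ℕ) (n : ℕ) :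
    ∃ D : WSpace c m (n + 1) ≃ₗᵢ[ℂ] WSpace c m n,
      (∀ (f : WSpace c m (n + 1)) (a : WIndex α n), D f a =ᵐ[wMeasure c m n a] fun ω =>
        (Real.sqrt α.range.index : ℂ) *
          f ((a, c.tau ω) : WIndex α n × _) (dualEndo α ω)) ∧
      ∀ γ f, D (charSumRep (wMeasure c m (n + 1)) γ f) =
        charSumRep (wMeasure c m n) (α γ) (D f) := by
  obtain ⟨D, hD⟩ := exists_undilate c (wMeasure c m n)
  exact ⟨D, hD, charSumRep_undilate c hD⟩

/-- The inclusion of the core space into the canonical space. -/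
def coreInclusion (c : CrossSection α) (m : PontryaginDual Γ → ℕ) :
    CoreSpace m →ₗᵢ[ℂ] CanonicalSpace c m where
  toFun f := WithLp.toLp 2 (f, 0)
  map_add' _ _ := (WithLp.ofLp_injective 2) (Prod.ext rfl (add_zero _).symm)
  map_smul' a _ := (WithLp.ofLp_injective 2) (Prod.ext rfl (smul_zero a).symm)
  norm_map' f := WithLp.norm_toLp_fst 2 _ _ f

end CanonicalGMRA

end

/-! ### Assembly of the theorem. -/

theorem mainTheorem4 {Γ : Type*} [CommGroup Γ] [Countable Γ] [TopologicalSpace Γ]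
    [DiscreteTopology Γ]
    (α : Γ →* Γ) (hα : Function.Injective α) (hN : 1 < α.range.index)
    (hα_inter : ⋂ n : ℕ, Set.range (α^[n]) = {1})
    {E : Type*} [NormedAddCommGroup E] [InnerProductSpace ℂ E] [CompleteSpace E]
    [TopologicalSpace.SeparableSpace E]
    (π : Γ →* (E ≃ₗᵢ[ℂ] E)) (δ : E ≃ₗᵢ[ℂ] E) (V : ℤ → Submodule ℂ E)
    (hV : IsGMRA α π δ V)
    (m : PontryaginDual Γ → ℕ) (hm : Measurable m)
    (J : V 0 ≃ₗᵢ[ℂ] CoreSpace m) (hJ : IsStoneMap hV m J)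
    (H : ℕ → ℕ → PontryaginDual Γ → ℂ) (hH : IsConstructedFilter hV m J H)
    (G : ℕ → ℕ → PontryaginDual Γ → ℂ) (hG : IsComplementaryFilter α m H G)
    (c : CrossSection α) :
    IsMultiplicityFunction α m ∧ IsFilter α m H ∧
    (∃ T, IsCanonicalInverseDilation c m H G T) ∧
    ∀ T, IsCanonicalInverseDilation c m H G T →
      IsGMRA α (canonicalRep c m) T⁻¹ (canonicalSubspace c m T) ∧
      GMRAEquivalent π δ V (canonicalRep c m) T⁻¹ (canonicalSubspace c m T) := by
  -- An infinite index has the value `0`, so `1 < N` already contains finiteness.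
  have hfin : α.range.FiniteIndex := ⟨by omega⟩
  have hS := coreIsometry_covariant hJ
  have hF : IsFilter α m H := isFilter_of_covariant c hm _ hS hH.supported hH.isRowOf
  have hSr := isRuelle_of_covariant c hm hS hH.supported hH.isRowOf
  obtain ⟨R, hR⟩ := hG.isRowFilter.exists_linearIsometry c hm (measurable_coMultNat c hm)
    (wIndexEquiv α) (wMeasure c m 0) (wMeasure_zero c m)
  have hRr : IsRuelle α (coMultNat α m) G (wIndexEquiv α) R := hR
  choose D hD hDγ using exists_wUndilate c m
  obtain ⟨T₀, hT₀⟩ := exists_isShiftType (W := fun n => WSpace c m n) (coreIsometry hV J) R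
    (fun f g => inner_eq_zero_symm.1 (hRr.inner_eq_zero c hm (measurable_coMultNat c hm) hm
      hG.supported hF.supported hSr hG.orthogonal g f))
    (fun x h h' => eq_zero_of_forall_inner_eq_zero c hm hF hG (fun k => rfl) (wMeasure_zero c m)
      hSr hRr h h') D
  have hT₀c : IsCanonicalInverseDilation c m H G T₀ := by
    refine ⟨fun f j => ?_, fun f n a => ?_⟩
    · rw [hT₀.fst, coMultSet_eq]
      have h1 : (coreIsometry hV J f.fst + R (f.snd 0)) j =ᵐ[coreMeasure m j]
          ⇑(coreIsometry hV J f.fst j) + ⇑(R (f.snd 0) j) := Lp.coeFn_add _ _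
      filter_upwards [h1, hSr f.fst j, hR (f.snd 0) j] with ω h2 h3 h4
      rw [h2, Pi.add_apply, h3, h4]
      rfl
    · rw [hT₀.snd]
      exact hD n (f.snd (n + 1)) a
  refine ⟨⟨hm, hF.isRowFilter.le_fiberSum c⟩, hF, ⟨T₀, hT₀c⟩, fun T hT => ?_⟩
  -- The formula determines the operator, so an arbitrary `T` inherits the shift structure of `T₀`.
  obtain rfl := hT.unique hT₀c
  refine hV.equivalent_of_core T (canonicalRep c m) (canonicalCore c m)
    ((coreInclusion c m).comp J.toLinearIsometry) ?_ (fun x => ?_) (fun γ x => ?_)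
    (fun γ f => ?_) hT₀.dense
  · ext f
    constructor
    · rintro ⟨x, rfl⟩
      rfl
    · intro hf
      have hf' : f.snd = 0 := hf
      exact ⟨J.symm f.fst, (WithLp.ofLp_injective 2)
        (Prod.ext (J.apply_symm_apply f.fst) hf'.symm)⟩
  · refine (WithLp.ofLp_injective 2) (Prod.ext ?_ (lp.ext (funext fun n => ?_)))
    · refine (hT₀.fst _).trans ?_
      change coreIsometry hV J (J x) + R 0 = _
      rw [map_zero, add_zero]
      refine congrArg J (Subtype.ext ?_)
      change δ.symm (J.symm (J x) : E) = δ.symm x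
      rw [J.symm_apply_apply]
    · exact (hT₀.snd _ n).trans (map_zero (D n))
  · refine (WithLp.ofLp_injective 2) (Prod.ext (hJ γ x) ?_)
    exact (map_zero (hilbertSumRep (fun n => charSumRep (wMeasure c m n)) γ)).symm
  · refine (WithLp.ofLp_injective 2) (Prod.ext ?_ (lp.ext (funext fun n => ?_)))
    · refine (hT₀.fst _).trans ?_
      change coreIsometry hV J (charSumRep (coreMeasure m) γ f.fst) +
        R (charSumRep (wMeasure c m 0) γ (f.snd 0)) =
        charSumRep (coreMeasure m) (α γ) (T f).fst
      rw [hS, hRr.covariant c (measurable_coMultNat c hm) (wMeasure_zero c m), hT₀.fst, map_add]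
    · refine (hT₀.snd _ n).trans ?_
      change D n (charSumRep (wMeasure c m (n + 1)) γ (f.snd (n + 1))) =
        charSumRep (wMeasure c m n) (α γ) ((T f).snd n)
      rw [hDγ, hT₀.snd]
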